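/- **Setting.** Let $n,m\ge 1$ and $p\ge 0$ be integers. Agents $[n]$ are the vertices of an undirected connected graph $\mathcal G$, and $W=[w_{ij}]\in\mathbb R^{n\times n}$ is a nonnegative symmetric matrix with $W\mathbf 1=\mathbf 1$ such that, for $i\ne j$, $\{i,j\}$ is an edge of $\mathcal G$ if and only if $w_{ij}>0$. Assume moreover that $w_{ii}>0$ for some $i$ or that $\mathcal G$ is not bipartite (for connected $\mathcal G$ this is equivalent to $\rho_w<1$ for the number $\rho_w$ defined next). Let $\rho_w$ be the spectral norm of $W-\frac1n\mathbf 1\mathbf 1^{\intercal}$. Let $\mu>0$, $L\in\mathbb R$, and let $f_{i,\ell}:\mathbb R^p\to\mathbb R$ ($i\in[n]$, $\ell\in[m]$) be differentiable with $$\langle\nabla f_{i,\ell}(x)-\nabla f_{i,\ell}(x'),x-x'\rangle\ge\mu\|x-x'\|^2,\qquad \|\nabla f_{i,\ell}(x)-\nabla f_{i,\ell}(x')\|\le L\|x-x'\|\qquad\text{for all }x,x'\in\mathbb R^p .$$ Let $x^*$ be a minimizer of $\frac1n\sum_{i=1}^n\frac1m\sum_{\ell=1}^m f_{i,\ell}$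 and put $\sigma_*^2:=\frac1{mn}\sum_{i=1}^n\sum_{\ell=1}^m\|\nabla f_{i,\ell}(x^*)\|^2$. **Algorithm (distributed random reshuffling, D-RR).** Start from deterministic points $x_{1,0},\dots,x_{n,0}\in\mathbb R^p$. In epoch $t=0,1,2,\dots$ every agent $i$ draws a uniformly random permutation $(\pi_0^i,\dots,\pi_{m-1}^i)$ of $[m]$, all draws being independent over agents and epochs, sets $x_{i,t}^0=x_{i,t}$, performs for $\ell=0,\dots,m-1$ the step $$x_{i,t}^{\ell+1}=\sum_{j=1}^n w_{ij}\bigl(x_{j,t}^{\ell}-\alpha_t\nabla f_{j,\pi_\ell^j}(x_{j,t}^{\ell})\bigr),$$ and sets $x_{i,t+1}=x_{i,t}^m$. Write $\bar x_0=\frac1n\sum_i x_{i,0}$, $D:=\|\bar x_0-x^*\|^2$ and $E:=\frac1n\sum_{i=1}^n\|x_{i,0}-\bar x_0\|^2$. **Theorem.** Let $\alpha_t=\frac{\theta}{m\mu(t+K)}$ with $\theta>12$ and a real number $$K\ge\max\left\{\frac\theta2,\ \sqrt{\frac{24\rho_w^2(5-\rho_w^2)L^2\theta^2}{(2-\rho_w^2)(1-\rho_w^2)^2m^2\mu^2}},\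 \frac{2\theta}{m(1-\rho_w^2)},\ \frac{8\sqrt{30}\,L^2\theta}{(1-\rho_w^2)m\mu^2}\right\}.$$ (i) For every $t\ge0$ the random variables $\|x_{i,t}-x^*\|^2$ are integrable and $$\frac1n\sum_{i=1}^n\mathbb E\|x_{i,t}-x^*\|^2\le\Bigl(\frac K{t+K}\Bigr)^{\theta/2}D+\Bigl(C_1+\Bigl(\frac{1+\rho_w^2}2\Bigr)^{mt}\Bigr)E+\frac{C_2}{(t+K)^2},$$ where $$C_1=\Bigl(\frac K{t+K}\Bigr)^{\theta/2}\frac{96L^2}{\mu^2(1-\rho_w^2)},$$ $$C_2=\frac{2\theta^3L\sigma_*^2}{m\mu^3(\theta-4)}+\frac{96\theta^3L^2\hat X_1}{nm^2\mu^4(1-\rho_w^2)^2(\theta-4)}+\frac{4\theta^2\hat X_1}{n\mu^2m^2(1-\rho_w^2)^2},$$ $$\hat X_1=\frac{30nL^2}{1-\rho_w^2}\hat X_0+\frac{15n\rho_w^2}{1-\rho_w^2}\sigma_*^2+\frac{mn\mu(1-\rho_w^2)}{8L}\sigma_*^2,\qquad \hat X_0=H_0+\frac{28(m\mu+L)\sigma_*^2}{\mu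 L^2},$$ $$H_0=D+\omega_0\,nE,\qquad \omega_0=\frac{16\alpha_0L^2}{n\mu(1-\rho_w^2)}.$$ (In the degenerate case $p=0$, where $L=0$ is possible, fractions with denominator $0$ are read as $0$.) (ii) Consequently D-RR has the rate $\mathcal O(1/(mT^2))$: there is a function $C$ of seven real variables such that in every such setting there is $T_0$ with $$\frac1n\sum_{i=1}^n\mathbb E\|x_{i,T}-x^*\|^2\le\frac{C(\theta,\mu,L,\rho_w,\sigma_*^2,D,E)}{mT^2}\qquad\text{for all }T\ge T_0 ;$$ the constant does not depend on $m$, $n$, $p$, $K$ otherwise than through its arguments, while $T_0$ may depend on the whole setting. -/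

import Mathlib

namespace DRR

noncomputable section

/-- The parameter space `ℝ^p` with its Euclidean norm. -/
abbrev Vec (p : ℕ) : Type := EuclideanSpace ℝ (Fin p)

/-- `W` is a nonnegative, symmetric, stochastic mixing matrix compliant with the (undirected) graph
`G`: distinct agents `i`, `j` are linked exactly when `W i j > 0`. -/
structure IsMixingMatrix {n : ℕ} (G : SimpleGraph (Fin n)) (W : Matrix (Fin n) (Fin n) ℝ) :
    Prop where
  symm : W.IsSymm
  nonneg : ∀ i j, 0 ≤ W i j
  stochastic : ∀ i, ∑ j, W i j = 1
  adj_iff : ∀ i j, i ≠ j → (G.Adj i j ↔ 0 < W i j)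

/-- The spectral norm `ρ_w` of `W - (1/n) 1 1ᵀ`. -/
def rhoW {n : ℕ} (W : Matrix (Fin n) (Fin n) ℝ) : ℝ :=
  ‖Matrix.toEuclideanCLM (n := Fin n) (𝕜 := ℝ) (W - Matrix.of fun _ _ => (n : ℝ)⁻¹)‖

/-- `f : ℝ^p → ℝ` is differentiable, `μ`-strongly convex and `L`-smooth. -/
structure IsStronglyConvexSmooth {p : ℕ} (μ L : ℝ) (f : Vec p → ℝ) : Prop where
  differentiable : Differentiable ℝ f
  strong : ∀ x y, μ * ‖x - y‖ ^ 2 ≤ inner ℝ (gradient f x - gradient f y) (x - y)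
  smooth : ∀ x y, ‖gradient f x - gradient f y‖ ≤ L * ‖x - y‖

/-- The global objective `f(x) = (1/n) ∑ᵢ (1/m) ∑_ℓ f_{i,ℓ}(x)`. -/
def objective {n m p : ℕ} (f : Fin n → Fin m → Vec p → ℝ) (x : Vec p) : ℝ :=
  (1 / (n : ℝ)) * ∑ i, (1 / (m : ℝ)) * ∑ l, f i l x

/-- The average `x̄` of the agents' vectors. -/
def avg {n p : ℕ} (x : Fin n → Vec p) : Vec p :=
  (1 / (n : ℝ)) • ∑ i, x i

/-- The consensus error `‖𝐱 - 1 x̄ᵀ‖²` (squared Frobenius norm). -/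
def consErr {n p : ℕ} (x : Fin n → Vec p) : ℝ :=
  ∑ i, ‖x i - avg x‖ ^ 2

/-- The inner loop of an epoch with stepsize `α` and permutations `σ i` (agent `i` uses component
`σ i l` in step `l`), started at `x`: `inner … l` is the stacked iterate after `l` steps, for
`l ≤ m`. Each step is a local gradient step followed by mixing with `W`. -/
def innerIter {n m p : ℕ} (W : Matrix (Fin n) (Fin n) ℝ) (f : Fin n → Fin m → Vec p → ℝ) (α : ℝ)
    (σ : Fin n → Equiv.Perm (Fin m)) (x : Fin n → Vec p) : ℕ → Fin n → Vec p
  | 0 => x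
  | l + 1 =>
    if h : l < m then fun i =>
      ∑ j, W i j • (innerIter W f α σ x l j -
        α • gradient (f j (σ j ⟨l, h⟩)) (innerIter W f α σ x l j))
    else innerIter W f α σ x l

/-- The stacked iterate `(x_{i,t})ᵢ` of D-RR at the beginning of epoch `t`, for given stepsizes `α`,
permutations `π t i` (epoch `t`, agent `i`) and starting points `x₀`. -/
def iterate {n m p : ℕ} (W : Matrix (Fin n) (Fin n) ℝ) (f : Fin n → Fin m → Vec p → ℝ) (α : ℕ → ℝ)
    (π : ℕ → Fin n → Equiv.Perm (Fin m)) (x₀ : Fin n → Vec p) : ℕ → Fin n → Vec p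
  | 0 => x₀
  | t + 1 => innerIter W f (α t) (π t) (iterate W f α π x₀ t) m

/-- The permutations `π t i` (epoch `t`, agent `i`) are mutually independent and each is uniformly
distributed on the permutations of `Fin m`. -/
structure IsUniformReshuffling {Ω : Type*} [MeasurableSpace Ω] (P : MeasureTheory.Measure Ω)
    {n m : ℕ} (π : ℕ → Fin n → Ω → Equiv.Perm (Fin m)) : Prop where
  measurable : ∀ t i σ, MeasurableSet {ω | π t i ω = σ}
  indep : ProbabilityTheory.iIndepFun (m := fun _ => ⊤) (fun (a : ℕ × Fin n) => π a.1 a.2) P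
  uniform : ∀ t i σ, P {ω | π t i ω = σ} = ((m.factorial : ℕ) : ENNReal)⁻¹

/-- `(1/n) ∑ᵢ E‖x_{i,t} - x⋆‖²` for the iterates of D-RR. -/
def expErr {Ω : Type*} [MeasurableSpace Ω] (P : MeasureTheory.Measure Ω) {n m p : ℕ}
    (W : Matrix (Fin n) (Fin n) ℝ) (f : Fin n → Fin m → Vec p → ℝ) (α : ℕ → ℝ)
    (π : ℕ → Fin n → Ω → Equiv.Perm (Fin m)) (x₀ : Fin n → Vec p) (xs : Vec p) (t : ℕ) : ℝ :=
  (1 / (n : ℝ)) * ∑ i, ∫ ω, ‖iterate W f α (fun s j => π s j ω) x₀ t i - xs‖ ^ 2 ∂P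

/-- The stepsize `α_t = θ / (m μ (t + K))`. -/
def stepsize (m : ℕ) (θ μ K : ℝ) (t : ℕ) : ℝ :=
  θ / (m * μ * (t + K))

/-- The lower bound required of `K`. -/
def Kmin (m : ℕ) (θ μ L ρ : ℝ) : ℝ :=
  max (max (θ / 2)
      (√(24 * ρ ^ 2 * (5 - ρ ^ 2) * L ^ 2 * θ ^ 2 /
        ((2 - ρ ^ 2) * (1 - ρ ^ 2) ^ 2 * m ^ 2 * μ ^ 2))))
    (max (2 * θ / (m * (1 - ρ ^ 2))) (8 * √30 * L ^ 2 * θ / ((1 - ρ ^ 2) * m * μ ^ 2)))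

/-- `σ_*² = (1/(mn)) ∑ᵢ ∑_ℓ ‖∇f_{i,ℓ}(x⋆)‖²`. -/
def sigmaSq {n m p : ℕ} (f : Fin n → Fin m → Vec p → ℝ) (xs : Vec p) : ℝ :=
  (1 / ((m : ℝ) * n)) * ∑ i, ∑ l, ‖gradient (f i l) xs‖ ^ 2

/-- `ω_0 = 16 α_0 L² / (n μ (1 - ρ²))` as a function of the initial stepsize `α₀`. -/
def omega0 (n : ℕ) (μ L ρ α₀ : ℝ) : ℝ :=
  16 * α₀ * L ^ 2 / (n * μ * (1 - ρ ^ 2))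

/-- `H_0 = ‖x̄_0 - x⋆‖² + ω_0 ‖𝐱_0 - 1 x̄_0ᵀ‖²`. -/
def H0 {n p : ℕ} (μ L ρ α₀ : ℝ) (x₀ : Fin n → Vec p) (xs : Vec p) : ℝ :=
  ‖avg x₀ - xs‖ ^ 2 + omega0 n μ L ρ α₀ * consErr x₀

/-- `X̂_0` as a function of `H_0` and `s = σ_*²`. -/
def X0 (m : ℕ) (μ L s h : ℝ) : ℝ :=
  h + 28 * (m * μ + L) * s / (μ * L ^ 2)

/-- `X̂_1` as a function of `H_0` and `s = σ_*²`. -/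
def X1 (n m : ℕ) (μ L ρ s h : ℝ) : ℝ :=
  30 * n * L ^ 2 / (1 - ρ ^ 2) * X0 m μ L s h + 15 * n * ρ ^ 2 / (1 - ρ ^ 2) * s
    + m * n * μ * (1 - ρ ^ 2) / (8 * L) * s

/-- The coefficient `C₁` (it depends on the epoch `t`). -/
def C1 (θ μ L ρ K : ℝ) (t : ℕ) : ℝ :=
  (K / (t + K)) ^ (θ / 2) * (96 * L ^ 2 / (μ ^ 2 * (1 - ρ ^ 2)))

/-- The coefficient `C₂`, with `s = σ_*²` and `X = X̂_1`. -/
def C2 (n m : ℕ) (θ μ L ρ s X : ℝ) : ℝ :=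
  2 * θ ^ 3 * L * s / (m * μ ^ 3 * (θ - 4))
    + 96 * θ ^ 3 * L ^ 2 * X / (n * m ^ 2 * μ ^ 4 * (1 - ρ ^ 2) ^ 2 * (θ - 4))
    + 4 * θ ^ 2 * X / (n * μ ^ 2 * m ^ 2 * (1 - ρ ^ 2) ^ 2)

end

end DRR

/-!
The proof separates two errors: the consensus error of the agents, and the distance of the averaged
iterate from a *shadow sequence*, which starts each epoch at the minimizer `x⋆` and performs
averaged gradient steps with the permutations of the epoch, all gradients being evaluated at `x⋆`.
Since the gradients of all components sum to zero at `x⋆`, the shadow sequence is back at `x⋆` at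
the end of the epoch, whatever the permutations are (`shadow_last`); this is where reshuffling gains
over independent sampling. In between, it strays from `x⋆` by an average over the agents of centred
sums drawn without replacement, whose second moment is at most `α² m σ_*²`
(`integral_norm_shadow_sub_sq_le`).

In each inner step the tracking error contracts by strong convexity, with the consensus error and
the shadow displacement as perturbations (`norm_avg_step_sub_sq_le`); the consensus error contracts
because mixing shrinks deviations from the mean by `ρ_w` (`consErr_step_le`). Here `ρ_w < 1`
(`rhoW_lt_one`): a vector whose norm is preserved by mixing turns every edge into a swap of two
values, so on a connected graph it is constant or yields a proper 2-colouring with no self-weights.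
These inequalities hold for every realisation of the permutations, so only the moments of the shadow
displacement and of the gradients at `x⋆` remain to be computed, from the uniform law of a single
permutation.

What remains is a pair of coupled scalar recursions (`ErrorRecursion`). A Lyapunov function
combining both errors shows that the tracking error is bounded (`ErrorRecursion.a_le`). Hence the
noise in the consensus recursion is of the order of the squared stepsize, and the consensus error is
a geometrically decaying term plus a term of that order (`ErrorRecursion.b_le`). Inserting this
bound into the tracking recursion gives, over an epoch, a contraction by `exp (-θ / (t + K))` with
noise of order `(t + K)⁻³`, and induction over the epochs gives the decay `(t + K)⁻²`
(`ErrorRecursion.a_zero_le`). The numerical constants fit because `X̂_1` dominates every noise term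
with room to spare.
-/

namespace DRR

/-! ### The mixing matrix -/

section Mixing

variable {n p : ℕ} {G : SimpleGraph (Fin n)} {W : Matrix (Fin n) (Fin n) ℝ}

lemma IsMixingMatrix.sum_col (hW : IsMixingMatrix G W) (j : Fin n) : ∑ i, W i j = 1 := by
  rw [← hW.stochastic j]
  exact Finset.sum_congr rfl fun i _ => hW.symm.apply j i

lemma rhoW_nonneg (W : Matrix (Fin n) (Fin n) ℝ) : 0 ≤ rhoW W := norm_nonneg _

lemma toEuclideanCLM_sub_mean_apply (W : Matrix (Fin n) (Fin n) ℝ)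
    (x : EuclideanSpace ℝ (Fin n)) (i : Fin n) :
    Matrix.toEuclideanCLM (n := Fin n) (𝕜 := ℝ) (W - Matrix.of fun _ _ => (n : ℝ)⁻¹) x i
      = ∑ j, W i j * x j - (n : ℝ)⁻¹ * ∑ j, x j := by
  rw [Matrix.ofLp_toEuclideanCLM]
  simp [Matrix.mulVec, dotProduct, sub_mul, Finset.sum_sub_distrib, Finset.mul_sum]

/-- A mixing step contracts the deviation of a real vector from its mean by the factor `ρ_w`. -/
lemma sum_sq_mix_sub_mean_le (hn : 0 < n) (hW : IsMixingMatrix G W) (x : Fin n → ℝ) :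
    ∑ i, (∑ j, W i j * x j - (n : ℝ)⁻¹ * ∑ j, x j) ^ 2
      ≤ rhoW W ^ 2 * ∑ i, (x i - (n : ℝ)⁻¹ * ∑ j, x j) ^ 2 := by
  set c : ℝ := (n : ℝ)⁻¹ * ∑ j, x j with hc
  have hn' : (n : ℝ) ≠ 0 := by positivity
  let y : EuclideanSpace ℝ (Fin n) := WithLp.toLp 2 fun i => x i - c
  have h := (Matrix.toEuclideanCLM (n := Fin n) (𝕜 := ℝ)
    (W - Matrix.of fun _ _ => (n : ℝ)⁻¹)).le_opNorm y
  have h2 := pow_le_pow_left₀ (norm_nonneg _) h 2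
  rw [mul_pow, EuclideanSpace.norm_sq_eq, EuclideanSpace.norm_sq_eq] at h2
  have hy : ∑ j, y j = 0 := by
    simp only [y, Finset.sum_sub_distrib, Finset.sum_const, Finset.card_univ, Fintype.card_fin,
      nsmul_eq_mul, hc]
    field_simp
    ring
  have e : ∀ i, ∑ j, W i j * y j = ∑ j, W i j * x j - c := fun i => by
    simp only [y, mul_sub, Finset.sum_sub_distrib, ← Finset.sum_mul, hW.stochastic i, one_mul]
  simp only [toEuclideanCLM_sub_mean_apply, hy, mul_zero, sub_zero, e, Real.norm_eq_abs,
    sq_abs] at h2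
  exact h2

lemma avg_mix (hW : IsMixingMatrix G W) (z : Fin n → Vec p) :
    avg (fun i => ∑ j, W i j • z j) = avg z := by
  unfold avg
  rw [Finset.sum_comm]
  simp only [← Finset.sum_smul, hW.sum_col, one_smul]

lemma avg_apply (z : Fin n → Vec p) (k : Fin p) : avg z k = (n : ℝ)⁻¹ * ∑ j, z j k := by
  simp [avg]

lemma consErr_nonneg (z : Fin n → Vec p) : 0 ≤ consErr z :=
  Finset.sum_nonneg fun _ _ => by positivity

lemma consErr_mix_le (hn : 0 < n) (hW : IsMixingMatrix G W) (z : Fin n → Vec p) :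
    consErr (fun i => ∑ j, W i j • z j) ≤ rhoW W ^ 2 * consErr z := by
  unfold consErr
  rw [avg_mix hW]
  simp only [EuclideanSpace.norm_sq_eq, Real.norm_eq_abs, sq_abs]
  rw [Finset.sum_comm, Finset.sum_comm (f := fun i k => ((z i - avg z) k) ^ 2), Finset.mul_sum]
  refine Finset.sum_le_sum fun k _ => ?_
  have := sum_sq_mix_sub_mean_le hn hW fun j => z j k
  simpa [avg_apply] using this

/-- If mixing preserves the Euclidean norm of `y`, then equality holds in Jensen's inequality for
each row of `W`, so every `y j` with `W i j > 0` equals `(W y) i`. -/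
lemma eq_mix_of_norm_le (hW : IsMixingMatrix G W) (y : Fin n → ℝ)
    (h : ∑ i, y i ^ 2 ≤ ∑ i, (∑ j, W i j * y j) ^ 2) {i j : Fin n} (hij : 0 < W i j) :
    y j = ∑ k, W i k * y k := by
  set z : Fin n → ℝ := fun i => ∑ k, W i k * y k with hz
  have row : ∀ i, ∑ j, W i j * (y j - z i) ^ 2 = ∑ j, W i j * y j ^ 2 - z i ^ 2 := fun i => by
    have : ∀ j, W i j * (y j - z i) ^ 2
        = W i j * y j ^ 2 - 2 * z i * (W i j * y j) + z i ^ 2 * W i j := fun j => by ring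
    simp only [this, Finset.sum_add_distrib, Finset.sum_sub_distrib, ← Finset.mul_sum,
      hW.stochastic i]
    change _ - 2 * z i * z i + _ = _
    ring
  have tot : ∑ i, ∑ j, W i j * (y j - z i) ^ 2 ≤ 0 := by
    simp only [row, Finset.sum_sub_distrib]
    rw [Finset.sum_comm]
    simp only [← Finset.sum_mul, hW.sum_col, one_mul]
    linarith
  have nn : ∀ i j, 0 ≤ W i j * (y j - z i) ^ 2 := fun i j =>
    mul_nonneg (hW.nonneg i j) (sq_nonneg _)
  have h0 : W i j * (y j - z i) ^ 2 ≤ 0 :=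
    (Finset.single_le_sum (fun j _ => nn i j) (Finset.mem_univ j)).trans <|
      (Finset.single_le_sum (f := fun i => ∑ j, W i j * (y j - z i) ^ 2)
        (fun i _ => Finset.sum_nonneg fun j _ => nn i j) (Finset.mem_univ i)).trans tot
  have : (y j - z i) ^ 2 = 0 := by
    rcases mul_eq_zero.1 (le_antisymm h0 (nn i j)) with h | h
    · exact absurd h hij.ne'
    · exact h
  exact sub_eq_zero.1 (pow_eq_zero_iff two_ne_zero |>.1 this)

/-- A vector whose norm is preserved by mixing is constant: along each edge the pair
`(y i, (W y) i)` is swapped, so two distinct values would give a proper 2-colouring without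
self-loops. -/
lemma const_of_norm_mix (hG : G.Connected) (hW : IsMixingMatrix G W)
    (hb : (∃ i, 0 < W i i) ∨ ¬ G.Colorable 2) (y : Fin n → ℝ)
    (h : ∑ i, y i ^ 2 ≤ ∑ i, (∑ j, W i j * y j) ^ 2) (i j : Fin n) : y i = y j := by
  set z : Fin n → ℝ := fun i => ∑ k, W i k * y k with hz
  have key : ∀ i j, 0 < W i j → y j = z i := fun i j hij => eq_mix_of_norm_le hW y h hij
  have edge : ∀ {i j}, G.Adj i j → y j = z i ∧ z j = y i := fun {i j} hij =>
    ⟨key i j ((hW.adj_iff i j hij.ne).1 hij),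
      (key j i ((hW.adj_iff j i hij.ne').1 hij.symm)).symm⟩
  obtain ⟨i₀⟩ := hG.nonempty
  have cls : ∀ k, (y k = y i₀ ∧ z k = z i₀) ∨ (y k = z i₀ ∧ z k = y i₀) := fun k => by
    obtain ⟨w⟩ := hG.preconnected k i₀
    induction w with
    | nil => exact Or.inl ⟨rfl, rfl⟩
    | cons hadj _ ih =>
      obtain ⟨h1, h2⟩ := edge hadj
      rcases ih with ⟨h3, h4⟩ | ⟨h3, h4⟩
      · exact Or.inr ⟨h2 ▸ h4, h1 ▸ h3⟩
      · exact Or.inl ⟨h2 ▸ h4, h1 ▸ h3⟩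
  have hyz : y i₀ = z i₀ := by
    by_contra hne
    rcases hb with ⟨k, hk⟩ | hcol
    · have := key k k hk
      rcases cls k with ⟨h1, h2⟩ | ⟨h1, h2⟩
      · exact hne (by rw [← h1, ← h2, this])
      · exact hne (by rw [← h1, ← h2, this])
    · refine hcol ⟨SimpleGraph.Coloring.mk (fun k => if y k = y i₀ then (0 : Fin 2) else 1) ?_⟩
      intro a b hab heq
      obtain ⟨h1, h2⟩ := edge hab
      rcases cls a with ⟨h3, h4⟩ | ⟨h3, h4⟩
      · rw [if_pos h3, h1, h4, if_neg (Ne.symm hne)] at heq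
        exact absurd heq (by decide)
      · rw [h3, if_neg (Ne.symm hne), h1, h4, if_pos rfl] at heq
        exact absurd heq (by decide)
  have hk : ∀ k, y k = y i₀ := fun k => by
    rcases cls k with ⟨h1, _⟩ | ⟨h1, _⟩
    · exact h1
    · rw [h1, hyz]
  rw [hk i, hk j]

lemma rhoW_lt_one (hG : G.Connected) (hW : IsMixingMatrix G W)
    (hb : (∃ i, 0 < W i i) ∨ ¬ G.Colorable 2) : rhoW W < 1 := by
  obtain ⟨i₀⟩ := hG.nonempty
  have hn' : (n : ℝ) ≠ 0 := by
    have := i₀.pos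
    positivity
  set A := Matrix.toEuclideanCLM (n := Fin n) (𝕜 := ℝ) (W - Matrix.of fun _ _ => (n : ℝ)⁻¹)
    with hA
  have lt : ∀ x : EuclideanSpace ℝ (Fin n), ‖x‖ = 1 → ‖A x‖ < 1 := by
    intro x hx
    by_contra hge
    rw [not_lt] at hge
    set c : ℝ := (n : ℝ)⁻¹ * ∑ j, x j with hc
    have hsum : ∑ j, x j = n * c := by rw [hc]; field_simp
    have hAx : ∀ i, A x i = ∑ j, W i j * (x j - c) := fun i => by
      rw [hA, toEuclideanCLM_sub_mean_apply]
      simp only [mul_sub, Finset.sum_sub_distrib, ← Finset.sum_mul, hW.stochastic i, one_mul]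
      rfl
    have hAn : ‖A x‖ ^ 2 = ∑ i, (∑ j, W i j * (x j - c)) ^ 2 := by
      simp [EuclideanSpace.norm_sq_eq, hAx]
    have hxn : ∑ i, x i ^ 2 = 1 := by
      have := EuclideanSpace.norm_sq_eq x
      simp only [hx, Real.norm_eq_abs, sq_abs] at this
      linarith
    have hyn : ∑ i, (x i - c) ^ 2 ≤ 1 := by
      simp only [sub_sq, Finset.sum_add_distrib, Finset.sum_sub_distrib, hxn, Finset.sum_const,
        Finset.card_univ, Fintype.card_fin, nsmul_eq_mul, ← Finset.mul_sum, ← Finset.sum_mul, hsum]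
      nlinarith [mul_nonneg (Nat.cast_nonneg (α := ℝ) n) (sq_nonneg c)]
    have hconst := const_of_norm_mix hG hW hb (fun i => x i - c)
      (hyn.trans (by rw [← hAn]; nlinarith))
    have hz : ∀ i, x i - c = 0 := fun i => by
      have h1 : ∑ j, (x j - c) = n * (x i - c) := by
        rw [Finset.sum_congr rfl fun j _ => hconst j i]
        simp only [Finset.sum_const, Finset.card_univ, Fintype.card_fin, nsmul_eq_mul]
      have h2 : ∑ j, (x j - c) = 0 := by simp [Finset.sum_sub_distrib, hsum]
      rw [h2] at h1
      exact (mul_eq_zero.1 h1.symm).resolve_left hn'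
    have : ‖A x‖ ^ 2 = 0 := by rw [hAn]; simp [hz]
    nlinarith
  have hne : (Metric.sphere (0 : EuclideanSpace ℝ (Fin n)) 1).Nonempty :=
    ⟨EuclideanSpace.single i₀ 1, by simp⟩
  obtain ⟨x₁, hx₁, hmax⟩ := (isCompact_sphere (0 : EuclideanSpace ℝ (Fin n)) 1).exists_isMaxOn hne
    (A.continuous.norm.continuousOn)
  refine lt_of_le_of_lt (A.opNorm_le_bound (norm_nonneg (A x₁)) fun x => ?_)
    (lt x₁ (by simpa using hx₁))
  rcases eq_or_ne x 0 with rfl | hx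
  · simp
  · have hx' : ‖x‖ ≠ 0 := norm_ne_zero_iff.2 hx
    have h1 : ‖A (‖x‖⁻¹ • x)‖ ≤ ‖A x₁‖ := hmax (by simp [norm_smul, hx'])
    rw [map_smul, norm_smul, norm_inv, norm_norm, inv_mul_le_iff₀ (by positivity)] at h1
    linarith

end Mixing

/-! ### Averages and consensus errors -/

section Averages

variable {n p : ℕ}

/-- Young's inequality for the square of a norm, free of denominators. -/
lemma young_norm_sq {E : Type*} [NormedAddCommGroup E] [InnerProductSpace ℝ E] (s : ℝ) (u v : E) :
    (1 - s) * s * ‖u + v‖ ^ 2 ≤ s * ‖u‖ ^ 2 + (1 - s) * ‖v‖ ^ 2 := by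
  have h1 := norm_add_sq_real u v
  have h2 := norm_sub_sq_real (s • u) ((1 - s) • v)
  rw [norm_smul, norm_smul, real_inner_smul_left, real_inner_smul_right, mul_pow, mul_pow,
    Real.norm_eq_abs, Real.norm_eq_abs, sq_abs, sq_abs] at h2
  have h3 := sq_nonneg ‖s • u - (1 - s) • v‖
  rw [h1]
  linarith

lemma avg_add (u v : Fin n → Vec p) : avg (fun i => u i + v i) = avg u + avg v := by
  simp [avg, Finset.sum_add_distrib]

lemma avg_sub (u v : Fin n → Vec p) : avg (fun i => u i - v i) = avg u - avg v := by
  simp [avg, Finset.sum_sub_distrib, smul_sub]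

lemma avg_smul (c : ℝ) (u : Fin n → Vec p) : avg (fun i => c • u i) = c • avg u := by
  simp only [avg, ← Finset.smul_sum, smul_comm c]

lemma avg_const (hn : 0 < n) (c : Vec p) : avg (fun _ : Fin n => c) = c := by
  have : (n : ℝ) ≠ 0 := by positivity
  simp [avg, ← Nat.cast_smul_eq_nsmul ℝ, smul_smul, this]

lemma inner_avg_left (z : Fin n → Vec p) (u : Vec p) :
    inner ℝ (avg z) u = 1 / (n : ℝ) * ∑ i, inner ℝ (z i) u := by
  rw [avg, real_inner_smul_left, sum_inner]

/-- The parallel axis identity. -/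
lemma sum_norm_sub_sq (hn : 0 < n) (z : Fin n → Vec p) (c : Vec p) :
    ∑ i, ‖z i - c‖ ^ 2 = consErr z + n * ‖avg z - c‖ ^ 2 := by
  have hn' : (n : ℝ) ≠ 0 := by positivity
  have e : ∀ i, ‖z i - c‖ ^ 2 = ‖z i - avg z‖ ^ 2
      + 2 * inner ℝ (z i - avg z) (avg z - c) + ‖avg z - c‖ ^ 2 := fun i => by
    rw [← norm_add_sq_real, sub_add_sub_cancel]
  have h0 : ∑ i, inner ℝ (z i - avg z) (avg z - c) = (0 : ℝ) := by
    have := inner_avg_left (fun i => z i - avg z) (avg z - c)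
    rw [avg_sub, avg_const hn, sub_self, inner_zero_left] at this
    have h := (mul_eq_zero.1 this.symm).resolve_left (by positivity)
    exact h
  simp only [e, Finset.sum_add_distrib, ← Finset.mul_sum, h0, Finset.sum_const, Finset.card_univ,
    Fintype.card_fin, nsmul_eq_mul, consErr]
  ring

lemma consErr_le_sum_norm_sq (hn : 0 < n) (z : Fin n → Vec p) : consErr z ≤ ∑ i, ‖z i‖ ^ 2 := by
  have := sum_norm_sub_sq hn z 0
  simp only [sub_zero] at this
  rw [this]
  exact le_add_of_nonneg_right (by positivity)

lemma norm_avg_sq_le (hn : 0 < n) (z : Fin n → Vec p) :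
    ‖avg z‖ ^ 2 ≤ 1 / (n : ℝ) * ∑ i, ‖z i‖ ^ 2 := by
  have := sum_norm_sub_sq hn z 0
  simp only [sub_zero] at this
  have hn' : (0 : ℝ) < n := by positivity
  rw [this, mul_add, ← mul_assoc, one_div_mul_cancel hn'.ne', one_mul]
  exact le_add_of_nonneg_left (mul_nonneg (by positivity) (consErr_nonneg z))

lemma young_consErr (s : ℝ) (u v : Fin n → Vec p) :
    (1 - s) * s * consErr (fun i => u i + v i) ≤ s * consErr u + (1 - s) * consErr v := by
  unfold consErr
  rw [avg_add, Finset.mul_sum, Finset.mul_sum, Finset.mul_sum, ← Finset.sum_add_distrib]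
  refine Finset.sum_le_sum fun i _ => ?_
  rw [add_sub_add_comm]
  exact young_norm_sq s _ _

lemma norm_add_sq_le_two {E : Type*} [SeminormedAddCommGroup E] (a b : E) :
    ‖a + b‖ ^ 2 ≤ 2 * (‖a‖ ^ 2 + ‖b‖ ^ 2) := by
  nlinarith [norm_add_le a b, norm_nonneg (a + b), sq_nonneg (‖a‖ - ‖b‖)]

end Averages

/-! ### One inner step -/

section Step

variable {n p : ℕ} {μ L α : ℝ} {F : Fin n → Vec p → ℝ}

lemma IsStronglyConvexSmooth.norm_sub_sq_le {f : Vec p → ℝ} (hf : IsStronglyConvexSmooth μ L f)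
    (x y : Vec p) : ‖gradient f x - gradient f y‖ ^ 2 ≤ L ^ 2 * ‖x - y‖ ^ 2 := by
  rw [← mul_pow]
  exact pow_le_pow_left₀ (norm_nonneg _) (hf.smooth x y) 2

/-- The averaged iterate is compared with a shadow point `h` that moves along the gradients at
`xs`. The averaged gradient map is a contraction by strong convexity; the consensus error of the
agents and the distance of `h` from `xs` enter as perturbations. -/
lemma norm_avg_step_sub_sq_le (hn : 0 < n) (hμ : 0 < μ) (hα : 0 < α) (hαL : α * L ^ 2 ≤ μ / 2)
    (hαμ : α * μ ≤ 1 / 2) (hF : ∀ i, IsStronglyConvexSmooth μ L (F i)) (y : Fin n → Vec p)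
    (h xs : Vec p) :
    ‖avg (fun i => y i - α • gradient (F i) (y i)) - (h - α • avg fun i => gradient (F i) xs)‖ ^ 2
      ≤ (1 - α * μ) * ‖avg y - h‖ ^ 2
        + 4 * α * L ^ 2 / μ * (‖h - xs‖ ^ 2 + consErr y / n) := by
  have hn' : (0 : ℝ) < n := by positivity
  set u := avg y - h with hu
  set v := avg fun i => gradient (F i) (avg y) - gradient (F i) h with hv
  set w := avg fun i => (gradient (F i) (y i) - gradient (F i) (avg y))
    + (gradient (F i) h - gradient (F i) xs) with hw
  have e : avg (fun i => y i - α • gradient (F i) (y i)) - (h - α • avg fun i => gradient (F i) xs)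
      = (u - α • v) + -(α • w) := by
    rw [hv, hw, hu, avg_add, avg_sub, avg_sub, avg_sub, avg_sub, avg_smul]
    module
  have hin : μ * ‖u‖ ^ 2 ≤ inner ℝ u v := by
    rw [real_inner_comm, hv, inner_avg_left, one_div, ← div_eq_inv_mul, le_div_iff₀ hn']
    calc μ * ‖u‖ ^ 2 * n = ∑ _i : Fin n, μ * ‖u‖ ^ 2 := by simp; ring
      _ ≤ _ := Finset.sum_le_sum fun i _ => (hF i).strong _ _
  have hvn : ‖v‖ ^ 2 ≤ L ^ 2 * ‖u‖ ^ 2 := by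
    refine (norm_avg_sq_le hn _).trans ?_
    rw [one_div, ← div_eq_inv_mul, div_le_iff₀ hn']
    calc _ ≤ ∑ _i : Fin n, L ^ 2 * ‖u‖ ^ 2 :=
          Finset.sum_le_sum fun i _ => (hF i).norm_sub_sq_le _ _
      _ = _ := by simp; ring
  have hwn : ‖w‖ ^ 2 ≤ 2 * L ^ 2 * (‖h - xs‖ ^ 2 + consErr y / n) := by
    refine (norm_avg_sq_le hn _).trans ?_
    have : ∀ i, ‖(gradient (F i) (y i) - gradient (F i) (avg y))
        + (gradient (F i) h - gradient (F i) xs)‖ ^ 2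
        ≤ 2 * L ^ 2 * ‖h - xs‖ ^ 2 + 2 * L ^ 2 * ‖y i - avg y‖ ^ 2 := fun i => by
      have h1 := norm_add_sq_le_two (gradient (F i) (y i) - gradient (F i) (avg y))
        (gradient (F i) h - gradient (F i) xs)
      have h2 := (hF i).norm_sub_sq_le (y i) (avg y)
      have h3 := (hF i).norm_sub_sq_le h xs
      linarith
    have h2 := Finset.sum_le_sum fun i (_ : i ∈ Finset.univ) => this i
    simp only [Finset.sum_add_distrib, ← Finset.mul_sum, Finset.sum_const, Finset.card_univ,
      Fintype.card_fin, nsmul_eq_mul] at h2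
    change _ ≤ _ + 2 * L ^ 2 * consErr y at h2
    rw [one_div, ← div_eq_inv_mul, div_le_iff₀ hn', mul_add, add_mul]
    have e2 : 2 * L ^ 2 * (consErr y / n) * n = 2 * L ^ 2 * consErr y := by field_simp
    linarith
  have huv : ‖u - α • v‖ ^ 2 ≤ (1 - 3 / 2 * (α * μ)) * ‖u‖ ^ 2 := by
    rw [norm_sub_sq_real, real_inner_smul_right, norm_smul, Real.norm_eq_abs, mul_pow, sq_abs]
    have h1 := mul_le_mul_of_nonneg_left hin hα.le
    have h2 := mul_le_mul_of_nonneg_left hvn (sq_nonneg α)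
    have h3 : α ^ 2 * (L ^ 2 * ‖u‖ ^ 2) ≤ α * (μ / 2) * ‖u‖ ^ 2 := by
      have := mul_le_mul_of_nonneg_right (mul_le_mul_of_nonneg_left hαL hα.le) (sq_nonneg ‖u‖)
      linarith
    linarith
  set s := α * μ / 2 with hs
  have hs0 : 0 < s := by positivity
  have hs1 : 0 < 1 - s := by rw [hs]; linarith
  have hy := young_norm_sq s (u - α • v) (-(α • w))
  rw [← e, norm_neg, norm_smul α w, Real.norm_eq_abs, mul_pow, sq_abs] at hy
  have h4 : (1 - 3 / 2 * (α * μ)) * ‖u‖ ^ 2 ≤ (1 - s) * ((1 - α * μ) * ‖u‖ ^ 2) := by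
    have : (1 - 3 / 2 * (α * μ)) ≤ (1 - s) * (1 - α * μ) := by
      rw [hs]; nlinarith [sq_nonneg (α * μ)]
    nlinarith [mul_le_mul_of_nonneg_right this (sq_nonneg ‖u‖)]
  have h5 : α ^ 2 * ‖w‖ ^ 2 ≤ s * (4 * α * L ^ 2 / μ * (‖h - xs‖ ^ 2 + consErr y / n)) := by
    have := mul_le_mul_of_nonneg_left hwn (sq_nonneg α)
    refine this.trans (le_of_eq ?_)
    rw [hs]; field_simp; ring
  refine le_of_mul_le_mul_left ?_ (mul_pos hs1 hs0)
  refine hy.trans ?_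
  have h6 := mul_le_mul_of_nonneg_left (huv.trans h4) hs0.le
  have h7 := mul_le_mul_of_nonneg_left h5 hs1.le
  linarith

/-- Contraction of the consensus error in one inner step: mixing gains a factor `1 - δ`, Young's
inequality with parameter `δ / 4` separates the gradient step, and the gradients are compared with
those at `xs` through the shadow point `h`. -/
lemma consErr_step_le {G : SimpleGraph (Fin n)} {W : Matrix (Fin n) (Fin n) ℝ} {δ : ℝ}
    (hn : 0 < n) (hW : IsMixingMatrix G W) (hδ : 1 - rhoW W ^ 2 = δ) (hδ0 : 0 < δ)
    (hαL : 64 * (α ^ 2 * L ^ 2) ≤ δ ^ 2)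
    (hF : ∀ i, IsStronglyConvexSmooth μ L (F i)) (y : Fin n → Vec p) (h xs : Vec p) :
    consErr (fun i => ∑ j, W i j • (y j - α • gradient (F j) (y j))) / n
      ≤ (1 - δ / 2) * (consErr y / n) + 16 / δ * α ^ 2 * (L ^ 2 * ‖avg y - h‖ ^ 2
        + L ^ 2 * ‖h - xs‖ ^ 2 + 1 / (n : ℝ) * ∑ i, ‖gradient (F i) xs‖ ^ 2) := by
  have hn' : (0 : ℝ) < n := by positivity
  have hδ1 : δ ≤ 1 := by rw [← hδ]; nlinarith [sq_nonneg (rhoW W)]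
  have hρ : rhoW W ^ 2 = 1 - δ := by linarith
  set g : Fin n → Vec p := fun i => gradient (F i) (y i) with hg
  set T := L ^ 2 * consErr y + n * (L ^ 2 * ‖avg y - h‖ ^ 2) + n * (L ^ 2 * ‖h - xs‖ ^ 2)
    + ∑ i, ‖gradient (F i) xs‖ ^ 2 with hT
  have hgT : ∑ i, ‖g i‖ ^ 2 ≤ 4 * T := by
    have : ∀ i, ‖g i‖ ^ 2 ≤ 4 * (L ^ 2 * ‖y i - avg y‖ ^ 2) + 4 * (L ^ 2 * ‖avg y - h‖ ^ 2)
        + 4 * (L ^ 2 * ‖h - xs‖ ^ 2) + 4 * ‖gradient (F i) xs‖ ^ 2 := fun i => by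
      have e : g i = ((gradient (F i) (y i) - gradient (F i) (avg y))
          + (gradient (F i) (avg y) - gradient (F i) h))
          + ((gradient (F i) h - gradient (F i) xs) + gradient (F i) xs) := by
        simp only [hg]; abel
      have h0 := norm_add_sq_le_two ((gradient (F i) (y i) - gradient (F i) (avg y))
          + (gradient (F i) (avg y) - gradient (F i) h))
          ((gradient (F i) h - gradient (F i) xs) + gradient (F i) xs)
      have h1 := norm_add_sq_le_two (gradient (F i) (y i) - gradient (F i) (avg y))
          (gradient (F i) (avg y) - gradient (F i) h)
      have h2 := norm_add_sq_le_two (gradient (F i) h - gradient (F i) xs) (gradient (F i) xs)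
      have h3 := (hF i).norm_sub_sq_le (y i) (avg y)
      have h4 := (hF i).norm_sub_sq_le (avg y) h
      have h5 := (hF i).norm_sub_sq_le h xs
      rw [e]
      linarith
    have h2 := Finset.sum_le_sum fun i (_ : i ∈ Finset.univ) => this i
    simp only [Finset.sum_add_distrib, ← Finset.mul_sum, Finset.sum_const, Finset.card_univ,
      Fintype.card_fin, nsmul_eq_mul] at h2
    change _ ≤ 4 * (L ^ 2 * consErr y) + _ + _ + _ at h2
    rw [hT]
    linarith
  have hmix := consErr_mix_le hn hW fun j => y j - α • g j
  have hyoung := young_consErr (δ / 4) y fun j => -(α • g j)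
  simp only [← sub_eq_add_neg] at hyoung
  have hαg : consErr (fun j => -(α • g j)) ≤ α ^ 2 * (4 * T) := by
    refine (consErr_le_sum_norm_sq hn _).trans ?_
    simp only [norm_neg, norm_smul, mul_pow, Real.norm_eq_abs, sq_abs, ← Finset.mul_sum]
    exact mul_le_mul_of_nonneg_left hgT (sq_nonneg α)
  have hc0 := consErr_nonneg y
  have hT0 : 0 ≤ T := by positivity
  have hz : consErr (fun j => y j - α • g j) ≤ consErr y / (1 - δ / 4)
      + α ^ 2 * (4 * T) / (δ / 4) := by
    have h1 : (0 : ℝ) < 1 - δ / 4 := by linarith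
    have h2 : (0 : ℝ) < δ / 4 := by linarith
    rw [div_add_div _ _ h1.ne' h2.ne', le_div_iff₀ (mul_pos h1 h2)]
    nlinarith [mul_le_mul_of_nonneg_left hαg h1.le]
  have h1 : (1 - δ) * (consErr y / (1 - δ / 4)) ≤ (1 - 3 * δ / 4) * consErr y := by
    rw [mul_div_assoc', div_le_iff₀ (by linarith)]
    nlinarith [mul_nonneg (sq_nonneg δ) hc0]
  have h2 : (1 - δ) * (α ^ 2 * (4 * T) / (δ / 4)) ≤ 16 / δ * α ^ 2 * T := by
    have e : α ^ 2 * (4 * T) / (δ / 4) = 16 / δ * α ^ 2 * T := by field_simp; ring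
    rw [e]
    have : 0 ≤ 16 / δ * α ^ 2 * T := by positivity
    nlinarith
  have h3 : 16 / δ * α ^ 2 * (L ^ 2 * consErr y) ≤ δ / 4 * consErr y := by
    have e : 16 / δ * α ^ 2 * (L ^ 2 * consErr y) = 16 * (α ^ 2 * L ^ 2) * consErr y / δ := by
      field_simp
    rw [e, div_le_iff₀ hδ0]
    nlinarith [mul_le_mul_of_nonneg_right hαL hc0]
  have h4 := mul_le_mul_of_nonneg_left hz (by linarith : (0 : ℝ) ≤ 1 - δ)
  rw [hρ] at hmix
  rw [div_le_iff₀ hn']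
  refine hmix.trans (h4.trans ?_)
  have e : ((1 - δ / 2) * (consErr y / n) + 16 / δ * α ^ 2 * (L ^ 2 * ‖avg y - h‖ ^ 2
        + L ^ 2 * ‖h - xs‖ ^ 2 + 1 / (n : ℝ) * ∑ i, ‖gradient (F i) xs‖ ^ 2)) * n
      = (1 - δ / 2) * consErr y + (16 / δ * α ^ 2 * T - 16 / δ * α ^ 2 * (L ^ 2 * consErr y)) := by
    rw [hT]; field_simp; ring
  rw [e, mul_add]
  linarith

end Step

/-! ### Sums over uniformly random permutations -/

section Permutations

variable {m : ℕ}

/-- Averaging over all permutations, `σ k` is uniformly distributed. -/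
lemma sum_perm_apply (φ : Fin m → ℝ) (k : Fin m) :
    (m : ℝ) * ∑ σ : Equiv.Perm (Fin m), φ (σ k) = m.factorial * ∑ l, φ l := by
  have h : ∀ j, ∑ σ : Equiv.Perm (Fin m), φ (σ k) = ∑ σ : Equiv.Perm (Fin m), φ (σ j) := fun j => by
    rw [← Equiv.sum_comp (Equiv.mulRight (Equiv.swap k j))
      (fun σ : Equiv.Perm (Fin m) => φ (σ j))]
    simp
  calc (m : ℝ) * ∑ σ : Equiv.Perm (Fin m), φ (σ k)
      = ∑ _j : Fin m, ∑ σ : Equiv.Perm (Fin m), φ (σ k) := by simp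
    _ = ∑ j : Fin m, ∑ σ : Equiv.Perm (Fin m), φ (σ j) := Finset.sum_congr rfl fun j _ => h j
    _ = ∑ σ : Equiv.Perm (Fin m), ∑ j, φ (σ j) := Finset.sum_comm
    _ = ∑ _σ : Equiv.Perm (Fin m), ∑ l, φ l :=
        Finset.sum_congr rfl fun σ _ => Equiv.sum_comp σ φ
    _ = m.factorial * ∑ l, φ l := by simp [Fintype.card_perm]

variable {E : Type*} [NormedAddCommGroup E] [InnerProductSpace ℝ E]

/-- Entries of a centred population drawn without replacement are nonpositively correlated: for
fixed `k`, the correlations with all `k' ≠ k` agree and sum to minus the variance. -/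
lemma sum_perm_inner_nonpos (c : Fin m → E) (hc : ∑ l, c l = 0) {k k' : Fin m} (hk : k ≠ k') :
    ∑ σ : Equiv.Perm (Fin m), inner ℝ (c (σ k)) (c (σ k')) ≤ (0 : ℝ) := by
  set S : Fin m → ℝ := fun j => ∑ σ : Equiv.Perm (Fin m), inner ℝ (c (σ k)) (c (σ j)) with hS
  have hsymm : ∀ j ∈ Finset.univ.erase k, S j = S k' := fun j hj => by
    have hjk : k ≠ j := (Finset.ne_of_mem_erase hj).symm
    simp only [hS]
    rw [← Equiv.sum_comp (Equiv.mulRight (Equiv.swap j k'))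
      (fun σ : Equiv.Perm (Fin m) => inner ℝ (c (σ k)) (c (σ k')))]
    simp [Equiv.swap_apply_of_ne_of_ne hjk hk]
  have htot : ∑ j, S j = 0 := by
    simp only [hS]
    rw [Finset.sum_comm]
    refine Finset.sum_eq_zero fun σ _ => ?_
    rw [← inner_sum, Equiv.sum_comp σ c, hc, inner_zero_right]
  have hkk : 0 ≤ S k := Finset.sum_nonneg fun σ _ => real_inner_self_nonneg
  rw [← Finset.add_sum_erase _ _ (Finset.mem_univ k), Finset.sum_congr rfl hsymm,
    Finset.sum_const, nsmul_eq_mul] at htot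
  have hcard : (0 : ℝ) < (Finset.univ.erase k).card := by
    exact_mod_cast Finset.card_pos.2 ⟨k', by simp [hk.symm]⟩
  change S k' ≤ 0
  by_contra hpos
  rw [not_le] at hpos
  linarith [mul_pos hcard hpos]

/-- Partial sums of a centred population drawn without replacement have at most the variance of
independent draws. -/
lemma sum_perm_norm_sum_sq_le (c : Fin m → E) (hc : ∑ l, c l = 0) (s : Finset (Fin m)) :
    ∑ σ : Equiv.Perm (Fin m), ‖∑ k ∈ s, c (σ k)‖ ^ 2
      ≤ ∑ k ∈ s, ∑ σ : Equiv.Perm (Fin m), ‖c (σ k)‖ ^ 2 := by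
  have e : ∀ σ : Equiv.Perm (Fin m), ‖∑ k ∈ s, c (σ k)‖ ^ 2
      = ∑ k ∈ s, ∑ k' ∈ s, inner ℝ (c (σ k)) (c (σ k')) := fun σ => by
    rw [← real_inner_self_eq_norm_sq, sum_inner]
    simp only [inner_sum]
  simp only [e]
  rw [Finset.sum_comm]
  refine Finset.sum_le_sum fun k hk => ?_
  rw [Finset.sum_comm, ← Finset.add_sum_erase _ _ hk]
  have h1 : ∑ j ∈ s.erase k, ∑ σ : Equiv.Perm (Fin m), inner ℝ (c (σ k)) (c (σ j)) ≤ (0 : ℝ) :=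
    Finset.sum_nonpos fun j hj => sum_perm_inner_nonpos c hc (Finset.ne_of_mem_erase hj).symm
  simp only [real_inner_self_eq_norm_sq]
  linarith

/-- The variance of partial sums drawn without replacement, in terms of the uncentred second moment
of the population. -/
lemma sum_perm_norm_sum_sub_mean_sq_le (hm : 0 < m) {p : ℕ} (v : Fin m → Vec p)
    (s : Finset (Fin m)) :
    ∑ σ : Equiv.Perm (Fin m), ‖∑ k ∈ s, (v (σ k) - avg v)‖ ^ 2
      ≤ m.factorial * ∑ l, ‖v l‖ ^ 2 := by
  have hm' : (0 : ℝ) < m := by positivity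
  have hc : ∑ l, (v l - avg v) = 0 := by
    rw [Finset.sum_sub_distrib, Finset.sum_const, Finset.card_univ, Fintype.card_fin, avg,
      ← Nat.cast_smul_eq_nsmul ℝ, smul_smul, mul_one_div_cancel hm'.ne', one_smul, sub_self]
  refine (sum_perm_norm_sum_sq_le (fun l => v l - avg v) hc s).trans ?_
  have e : ∀ k, ∑ σ : Equiv.Perm (Fin m), ‖v (σ k) - avg v‖ ^ 2 = m.factorial * consErr v / m :=
    fun k => by
      rw [eq_div_iff hm'.ne', mul_comm]
      exact sum_perm_apply (fun l => ‖v l - avg v‖ ^ 2) k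
  simp only [e, Finset.sum_const, nsmul_eq_mul]
  have hs : (s.card : ℝ) ≤ m := by
    exact_mod_cast (Finset.card_le_univ s).trans_eq (Fintype.card_fin m)
  have h1 : (0 : ℝ) ≤ m.factorial * consErr v / m := by
    have := consErr_nonneg v
    positivity
  calc _ ≤ m * (m.factorial * consErr v / m) := mul_le_mul_of_nonneg_right hs h1
    _ = m.factorial * consErr v := by field_simp
    _ ≤ _ := mul_le_mul_of_nonneg_left (consErr_le_sum_norm_sq hm v) (by positivity)

end Permutations

/-! ### Random variables with finitely many values -/

section FiniteValued

open MeasureTheory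

variable {Ω : Type*} [MeasurableSpace Ω] {X Y : Type*}

/-- `g` takes finitely many values, each on a measurable set. The target carries no
measurable structure. -/
def FiniteValued (g : Ω → X) : Prop := ∃ s : SimpleFunc Ω X, ⇑s = g

lemma FiniteValued.comp {g : Ω → X} (hg : FiniteValued g) (F : X → Y) :
    FiniteValued fun ω => F (g ω) := by
  obtain ⟨s, rfl⟩ := hg
  exact ⟨s.map F, rfl⟩

lemma FiniteValued.prodMk {g : Ω → X} {h : Ω → Y} (hg : FiniteValued g) (hh : FiniteValued h) :
    FiniteValued fun ω => (g ω, h ω) := by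
  obtain ⟨s, rfl⟩ := hg
  obtain ⟨t, rfl⟩ := hh
  exact ⟨s.pair t, rfl⟩

lemma finiteValued_const (x : X) : FiniteValued fun _ : Ω => x := ⟨SimpleFunc.const Ω x, rfl⟩

lemma finiteValued_of_finite [Finite X] {g : Ω → X} (hg : ∀ x, MeasurableSet {ω | g ω = x}) :
    FiniteValued g :=
  ⟨⟨g, hg, Set.toFinite _⟩, rfl⟩

lemma finiteValued_pi {ι : Type*} [Finite ι] [Finite X] {g : ι → Ω → X}
    (hg : ∀ i x, MeasurableSet {ω | g i ω = x}) : FiniteValued fun ω i => g i ω := by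
  refine finiteValued_of_finite fun x => ?_
  have : {ω | (fun i => g i ω) = x} = ⋂ i, {ω | g i ω = x i} := by
    ext ω
    simp [funext_iff]
  rw [this]
  exact MeasurableSet.iInter fun i => hg i (x i)

lemma FiniteValued.integrable {P : Measure Ω} [IsFiniteMeasure P] {g : Ω → ℝ}
    (hg : FiniteValued g) : Integrable g P := by
  obtain ⟨s, rfl⟩ := hg
  exact s.integrable_of_isFiniteMeasure

/-- The expectation of a function of a uniformly random permutation. -/
lemma IsUniformReshuffling.integral_eq {P : Measure Ω} [IsProbabilityMeasure P] {n m : ℕ}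
    {π : ℕ → Fin n → Ω → Equiv.Perm (Fin m)} (hπ : IsUniformReshuffling P π) (t : ℕ) (i : Fin n)
    (φ : Equiv.Perm (Fin m) → ℝ) :
    ∫ ω, φ (π t i ω) ∂P = (m.factorial : ℝ)⁻¹ * ∑ σ, φ σ := by
  have e : (fun ω => φ (π t i ω))
      = fun ω => ∑ σ, Set.indicator {ω | π t i ω = σ} (fun _ => φ σ) ω := by
    funext ω
    rw [Finset.sum_eq_single (π t i ω)]
    · simp
    · intro σ _ hσ
      exact Set.indicator_of_notMem (by simpa using hσ.symm) _
    · simp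
  rw [e, integral_finsetSum _ fun σ _ => (integrable_const _).indicator (hπ.measurable t i σ),
    Finset.mul_sum]
  refine Finset.sum_congr rfl fun σ _ => ?_
  rw [integral_indicator_const _ (hπ.measurable t i σ), measureReal_def, hπ.uniform]
  simp

end FiniteValued

/-! ### The shadow sequence and the one-step recursions in expectation -/

section Shadow

open MeasureTheory

variable {n m p : ℕ}

/-- The shadow sequence of an epoch: it starts at `xs` and performs averaged gradient steps with the
permutations of the epoch, all gradients being evaluated at `xs`. It returns to `xs` at the end of
the epoch if `xs` is a critical point of the objective. -/
noncomputable def shadow (f : Fin n → Fin m → Vec p → ℝ) (α : ℝ) (σ : Fin n → Equiv.Perm (Fin m))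
    (xs : Vec p) (l : ℕ) : Vec p :=
  xs - α • avg fun i => ∑ k ∈ Finset.univ.filter (fun k : Fin m => (k : ℕ) < l),
    gradient (f i (σ i k)) xs

lemma shadow_zero (f : Fin n → Fin m → Vec p → ℝ) (α : ℝ) (σ : Fin n → Equiv.Perm (Fin m))
    (xs : Vec p) : shadow f α σ xs 0 = xs := by
  simp [shadow, avg]

lemma shadow_succ (f : Fin n → Fin m → Vec p → ℝ) (α : ℝ) (σ : Fin n → Equiv.Perm (Fin m))
    (xs : Vec p) {l : ℕ} (hl : l < m) :
    shadow f α σ xs (l + 1)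
      = shadow f α σ xs l - α • avg fun i => gradient (f i (σ i ⟨l, hl⟩)) xs := by
  have e : Finset.univ.filter (fun k : Fin m => (k : ℕ) < l + 1)
      = insert ⟨l, hl⟩ (Finset.univ.filter fun k : Fin m => (k : ℕ) < l) := by
    ext k
    simp only [Finset.mem_filter, Finset.mem_univ, true_and, Finset.mem_insert, Fin.ext_iff]
    omega
  simp only [shadow, e]
  rw [sub_sub, ← smul_add, ← avg_add]
  congr 3
  funext i
  rw [Finset.sum_insert (by simp), add_comm]

lemma sum_gradient_eq_zero (hn : 0 < n) (hm : 0 < m) {f : Fin n → Fin m → Vec p → ℝ}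
    (hf : ∀ i l, Differentiable ℝ (f i l)) {xs : Vec p}
    (hxs : IsMinOn (objective f) Set.univ xs) : ∑ i, ∑ l, gradient (f i l) xs = 0 := by
  have hn' : (n : ℝ) ≠ 0 := by positivity
  have hm' : (m : ℝ) ≠ 0 := by positivity
  have hd : HasFDerivAt (objective f)
      ((1 / (n : ℝ)) • ∑ i, (1 / (m : ℝ)) • ∑ l, fderiv ℝ (f i l) xs) xs := by
    unfold objective
    exact (HasFDerivAt.fun_sum fun i _ => (HasFDerivAt.fun_sum fun l _ =>
      ((hf i l) xs).hasFDerivAt).const_mul _).const_mul _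
  have h0 := (hxs.isLocalMin Filter.univ_mem).hasFDerivAt_eq_zero hd
  rw [← Finset.smul_sum, smul_smul, smul_eq_zero] at h0
  have h1 := h0.resolve_left (by positivity)
  have h2 : (InnerProductSpace.toDual ℝ (Vec p)) (∑ i, ∑ l, gradient (f i l) xs) = 0 := by
    simpa only [map_sum, toDual_gradient] using h1
  exact (LinearIsometryEquiv.map_eq_zero_iff _).1 h2

lemma shadow_last {f : Fin n → Fin m → Vec p → ℝ} (α : ℝ) (σ : Fin n → Equiv.Perm (Fin m))
    {xs : Vec p} (h0 : ∑ i, ∑ l, gradient (f i l) xs = 0) : shadow f α σ xs m = xs := by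
  have e : Finset.univ.filter (fun k : Fin m => (k : ℕ) < m) = Finset.univ := by
    ext k; simp
  simp only [shadow, e]
  have : ∀ i, ∑ k, gradient (f i (σ i k)) xs = ∑ l, gradient (f i l) xs := fun i =>
    Equiv.sum_comp (σ i) fun l => gradient (f i l) xs
  simp only [this, avg, h0, smul_zero, sub_zero]

lemma norm_shadow_sub_sq_le (hn : 0 < n) {f : Fin n → Fin m → Vec p → ℝ} (α : ℝ)
    (σ : Fin n → Equiv.Perm (Fin m)) {xs : Vec p} (h0 : ∑ i, ∑ l, gradient (f i l) xs = 0) (l : ℕ) :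
    ‖shadow f α σ xs l - xs‖ ^ 2 ≤ α ^ 2 * (1 / (n : ℝ) * ∑ i,
      ‖∑ k ∈ Finset.univ.filter (fun k : Fin m => (k : ℕ) < l),
        (gradient (f i (σ i k)) xs - avg fun j => gradient (f i j) xs)‖ ^ 2) := by
  set s := Finset.univ.filter (fun k : Fin m => (k : ℕ) < l) with hs
  have e : avg (fun i => ∑ k ∈ s, gradient (f i (σ i k)) xs)
      = avg fun i => ∑ k ∈ s, (gradient (f i (σ i k)) xs - avg fun j => gradient (f i j) xs) := by
    simp only [Finset.sum_sub_distrib, avg_sub, Finset.sum_const]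
    -- the subtracted means average to zero over the agents
    have : avg (fun i => s.card • avg fun j => gradient (f i j) xs) = 0 := by
      simp only [← Nat.cast_smul_eq_nsmul ℝ, avg_smul]
      rw [avg]
      simp only [avg, ← Finset.smul_sum, h0, smul_zero]
    rw [this, sub_zero]
  rw [shadow, sub_sub_cancel_left, norm_neg, norm_smul, mul_pow, Real.norm_eq_abs, sq_abs, ← hs, e]
  exact mul_le_mul_of_nonneg_left (norm_avg_sq_le hn _) (sq_nonneg α)

variable {Ω : Type*} [MeasurableSpace Ω] {P : Measure Ω}
  {π : ℕ → Fin n → Ω → Equiv.Perm (Fin m)}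

lemma IsUniformReshuffling.finiteValued (hπ : IsUniformReshuffling P π) (t : ℕ) :
    FiniteValued fun ω i => π t i ω :=
  finiteValued_pi fun i σ => hπ.measurable t i σ

lemma IsUniformReshuffling.integrable_apply [IsProbabilityMeasure P]
    (hπ : IsUniformReshuffling P π) (t : ℕ) (i : Fin n)
    (φ : Equiv.Perm (Fin m) → ℝ) : Integrable (fun ω => φ (π t i ω)) P :=
  ((hπ.finiteValued t).comp fun σ => φ (σ i)).integrable

/-- The shuffling variance: within an epoch the shadow sequence stays within `α² m σ_*²` of `xs`. -/
lemma integral_norm_shadow_sub_sq_le [IsProbabilityMeasure P]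
    (hn : 0 < n) (hm : 0 < m) (hπ : IsUniformReshuffling P π)
    {f : Fin n → Fin m → Vec p → ℝ} (α : ℝ) {xs : Vec p}
    (h0 : ∑ i, ∑ l, gradient (f i l) xs = 0) (t l : ℕ) :
    ∫ ω, ‖shadow f α (fun i => π t i ω) xs l - xs‖ ^ 2 ∂P ≤ α ^ 2 * (m * sigmaSq f xs) := by
  set s := Finset.univ.filter (fun k : Fin m => (k : ℕ) < l) with hs
  let φ : Fin n → Equiv.Perm (Fin m) → ℝ := fun i σ =>
    ‖∑ k ∈ s, (gradient (f i (σ k)) xs - avg fun j => gradient (f i j) xs)‖ ^ 2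
  have hm' : (0 : ℝ) < m := by positivity
  have hn' : (0 : ℝ) < n := by positivity
  calc ∫ ω, ‖shadow f α (fun i => π t i ω) xs l - xs‖ ^ 2 ∂P
      ≤ ∫ ω, α ^ 2 * (1 / (n : ℝ) * ∑ i, φ i (π t i ω)) ∂P := by
        refine integral_mono ?_ ?_ fun ω => norm_shadow_sub_sq_le hn α _ h0 l
        · exact ((hπ.finiteValued t).comp fun σ => ‖shadow f α σ xs l - xs‖ ^ 2).integrable
        · exact ((hπ.finiteValued t).comp fun σ =>
            α ^ 2 * (1 / (n : ℝ) * ∑ i, φ i (σ i))).integrable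
    _ = α ^ 2 * (1 / (n : ℝ) * ∑ i, (m.factorial : ℝ)⁻¹ * ∑ σ, φ i σ) := by
        rw [integral_const_mul, integral_const_mul,
          integral_finsetSum _ fun i _ => hπ.integrable_apply t i (φ i)]
        simp only [hπ.integral_eq t]
    _ ≤ α ^ 2 * (1 / (n : ℝ) * ∑ i, ∑ l, ‖gradient (f i l) xs‖ ^ 2) := by
        gcongr with i
        rw [inv_mul_le_iff₀ (by exact_mod_cast m.factorial_pos)]
        exact sum_perm_norm_sum_sub_mean_sq_le hm (fun j => gradient (f i j) xs) s
    _ = α ^ 2 * (m * sigmaSq f xs) := by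
        unfold sigmaSq; field_simp

lemma integral_gradient_sq_eq [IsProbabilityMeasure P]
    (hn : 0 < n) (hm : 0 < m) (hπ : IsUniformReshuffling P π)
    (f : Fin n → Fin m → Vec p → ℝ) (xs : Vec p) (t : ℕ) (k : Fin m) :
    ∫ ω, 1 / (n : ℝ) * ∑ i, ‖gradient (f i (π t i ω k)) xs‖ ^ 2 ∂P = sigmaSq f xs := by
  have hm' : (0 : ℝ) < m := by positivity
  have hn' : (0 : ℝ) < n := by positivity
  have hfac : (0 : ℝ) < m.factorial := by exact_mod_cast m.factorial_pos
  rw [integral_const_mul, integral_finsetSum _ fun i _ =>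
    hπ.integrable_apply t i fun σ => ‖gradient (f i (σ k)) xs‖ ^ 2]
  have : ∀ i, ∫ ω, ‖gradient (f i (π t i ω k)) xs‖ ^ 2 ∂P
      = 1 / (m : ℝ) * ∑ l, ‖gradient (f i l) xs‖ ^ 2 := fun i => by
    rw [hπ.integral_eq t i fun σ => ‖gradient (f i (σ k)) xs‖ ^ 2]
    have h := sum_perm_apply (fun l => ‖gradient (f i l) xs‖ ^ 2) k
    field_simp
    linarith
  simp only [this, ← Finset.mul_sum, sigmaSq]
  field_simp

lemma innerIter_succ (W : Matrix (Fin n) (Fin n) ℝ) (f : Fin n → Fin m → Vec p → ℝ) (α : ℝ)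
    (σ : Fin n → Equiv.Perm (Fin m)) (x : Fin n → Vec p) {l : ℕ} (hl : l < m) :
    innerIter W f α σ x (l + 1) = fun i => ∑ j, W i j • (innerIter W f α σ x l j -
      α • gradient (f j (σ j ⟨l, hl⟩)) (innerIter W f α σ x l j)) := by
  rw [innerIter, dif_pos hl]

lemma finiteValued_iterate (hπ : IsUniformReshuffling P π) (W : Matrix (Fin n) (Fin n) ℝ)
    (f : Fin n → Fin m → Vec p → ℝ) (α : ℕ → ℝ) (x₀ : Fin n → Vec p) (t : ℕ) :
    FiniteValued fun ω => iterate W f α (fun s j => π s j ω) x₀ t := by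
  induction t with
  | zero => exact finiteValued_const x₀
  | succ t ih =>
    exact ((hπ.finiteValued t).prodMk ih).comp fun q => innerIter W f (α t) q.1 q.2 m

/-- The expected squared distance of the averaged iterate from the shadow sequence after `l` inner
steps of epoch `t`. -/
noncomputable def trackErr (P : Measure Ω) (W : Matrix (Fin n) (Fin n) ℝ)
    (f : Fin n → Fin m → Vec p → ℝ) (α : ℕ → ℝ) (π : ℕ → Fin n → Ω → Equiv.Perm (Fin m))
    (x₀ : Fin n → Vec p) (xs : Vec p) (t l : ℕ) : ℝ :=
  ∫ ω, ‖avg (innerIter W f (α t) (fun j => π t j ω) (iterate W f α (fun s j => π s j ω) x₀ t) l)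
    - shadow f (α t) (fun j => π t j ω) xs l‖ ^ 2 ∂P

/-- The expected consensus error per agent after `l` inner steps of epoch `t`. -/
noncomputable def meanConsErr (P : Measure Ω) (W : Matrix (Fin n) (Fin n) ℝ)
    (f : Fin n → Fin m → Vec p → ℝ) (α : ℕ → ℝ) (π : ℕ → Fin n → Ω → Equiv.Perm (Fin m))
    (x₀ : Fin n → Vec p) (t l : ℕ) : ℝ :=
  ∫ ω, consErr (innerIter W f (α t) (fun j => π t j ω)
    (iterate W f α (fun s j => π s j ω) x₀ t) l) / n ∂P

variable {W : Matrix (Fin n) (Fin n) ℝ} {f : Fin n → Fin m → Vec p → ℝ} {α : ℕ → ℝ}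
  {x₀ : Fin n → Vec p} {xs : Vec p}

lemma integrable_epoch [IsProbabilityMeasure P]
    (hπ : IsUniformReshuffling P π) (W : Matrix (Fin n) (Fin n) ℝ)
    (f : Fin n → Fin m → Vec p → ℝ) (α : ℕ → ℝ) (x₀ : Fin n → Vec p) (t : ℕ)
    (Φ : (Fin n → Equiv.Perm (Fin m)) → (Fin n → Vec p) → ℝ) :
    Integrable (fun ω => Φ (fun j => π t j ω) (iterate W f α (fun s j => π s j ω) x₀ t)) P :=
  (((hπ.finiteValued t).prodMk (finiteValued_iterate hπ W f α x₀ t)).comp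
    fun q => Φ q.1 q.2).integrable

lemma trackErr_nonneg (t l : ℕ) : 0 ≤ trackErr P W f α π x₀ xs t l :=
  integral_nonneg fun _ => sq_nonneg _

lemma meanConsErr_nonneg (t l : ℕ) : 0 ≤ meanConsErr P W f α π x₀ t l :=
  integral_nonneg fun _ => div_nonneg (consErr_nonneg _) (Nat.cast_nonneg _)

lemma trackErr_init [IsProbabilityMeasure P]
    : trackErr P W f α π x₀ xs 0 0 = ‖avg x₀ - xs‖ ^ 2 := by
  simp [trackErr, innerIter, iterate, shadow_zero]

lemma meanConsErr_init [IsProbabilityMeasure P]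
    : meanConsErr P W f α π x₀ 0 0 = consErr x₀ / n := by
  simp [meanConsErr, innerIter, iterate]

lemma trackErr_epoch (h0 : ∑ i, ∑ l, gradient (f i l) xs = 0) (t : ℕ) :
    trackErr P W f α π x₀ xs (t + 1) 0 = trackErr P W f α π x₀ xs t m := by
  simp only [trackErr, innerIter, iterate, shadow_zero, shadow_last _ _ h0]

lemma meanConsErr_epoch (t : ℕ) :
    meanConsErr P W f α π x₀ (t + 1) 0 = meanConsErr P W f α π x₀ t m := by
  simp only [meanConsErr, innerIter, iterate]

lemma expErr_eq [IsProbabilityMeasure P] (hn : 0 < n) (hπ : IsUniformReshuffling P π) (t : ℕ) :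
    expErr P W f α π x₀ xs t
      = trackErr P W f α π x₀ xs t 0 + meanConsErr P W f α π x₀ t 0 := by
  have hn' : (0 : ℝ) < n := by positivity
  have hint : ∀ Φ : (Fin n → Vec p) → ℝ,
      Integrable (fun ω => Φ (iterate W f α (fun s j => π s j ω) x₀ t)) P := fun Φ =>
    ((finiteValued_iterate hπ W f α x₀ t).comp Φ).integrable
  simp only [expErr, trackErr, meanConsErr, innerIter, shadow_zero]
  rw [← integral_finsetSum _ fun i _ => hint fun x => ‖x i - xs‖ ^ 2, ← integral_const_mul,
    ← integral_add (hint fun x => ‖avg x - xs‖ ^ 2) (hint fun x => consErr x / n)]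
  refine integral_congr_ae (Filter.Eventually.of_forall fun ω => ?_)
  simp only [sum_norm_sub_sq hn]
  field_simp
  ring

variable {μ L δ : ℝ} {G : SimpleGraph (Fin n)}

lemma trackErr_succ_le [IsProbabilityMeasure P] (hn : 0 < n) (hm : 0 < m) (hW : IsMixingMatrix G W)
    (hf : ∀ i l, IsStronglyConvexSmooth μ L (f i l)) (hπ : IsUniformReshuffling P π)
    (h0 : ∑ i, ∑ l, gradient (f i l) xs = 0) (hμ : 0 < μ) {t l : ℕ} (hα : 0 < α t)
    (hαL : α t * L ^ 2 ≤ μ / 2) (hαμ : α t * μ ≤ 1 / 2) (hl : l < m) :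
    trackErr P W f α π x₀ xs t (l + 1) ≤ (1 - α t * μ) * trackErr P W f α π x₀ xs t l
      + 4 * α t * L ^ 2 / μ * (α t ^ 2 * (m * sigmaSq f xs) + meanConsErr P W f α π x₀ t l) := by
  have hint := integrable_epoch hπ W f α x₀ t
  refine le_trans (integral_mono (hint fun σ x => ‖avg (innerIter W f (α t) σ x (l + 1))
      - shadow f (α t) σ xs (l + 1)‖ ^ 2)
    (hint fun σ x => (1 - α t * μ) * ‖avg (innerIter W f (α t) σ x l) - shadow f (α t) σ xs l‖ ^ 2
      + 4 * α t * L ^ 2 / μ * (‖shadow f (α t) σ xs l - xs‖ ^ 2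
        + consErr (innerIter W f (α t) σ x l) / n)) fun ω => ?_) ?_
  · dsimp only
    rw [innerIter_succ _ _ _ _ _ hl, shadow_succ _ _ _ _ hl, avg_mix hW]
    exact norm_avg_step_sub_sq_le hn hμ hα hαL hαμ (fun i => hf i _) _ _ _
  · have hc : 0 ≤ 4 * α t * L ^ 2 / μ := by positivity
    rw [integral_add (hint fun σ x => (1 - α t * μ) *
        ‖avg (innerIter W f (α t) σ x l) - shadow f (α t) σ xs l‖ ^ 2)
      (hint fun σ x => 4 * α t * L ^ 2 / μ * (‖shadow f (α t) σ xs l - xs‖ ^ 2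
        + consErr (innerIter W f (α t) σ x l) / n)), integral_const_mul, integral_const_mul,
      integral_add (hint fun σ _ => ‖shadow f (α t) σ xs l - xs‖ ^ 2)
      (hint fun σ x => consErr (innerIter W f (α t) σ x l) / n)]
    have := integral_norm_shadow_sub_sq_le hn hm hπ (α t) h0 t l
    simp only [trackErr, meanConsErr]
    gcongr

lemma meanConsErr_succ_le [IsProbabilityMeasure P]
    (hn : 0 < n) (hm : 0 < m) (hW : IsMixingMatrix G W)
    (hf : ∀ i l, IsStronglyConvexSmooth μ L (f i l)) (hπ : IsUniformReshuffling P π)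
    (h0 : ∑ i, ∑ l, gradient (f i l) xs = 0) (hδ : 1 - rhoW W ^ 2 = δ) (hδ0 : 0 < δ) {t l : ℕ}
    (hαL : 64 * (α t ^ 2 * L ^ 2) ≤ δ ^ 2) (hl : l < m) :
    meanConsErr P W f α π x₀ t (l + 1) ≤ (1 - δ / 2) * meanConsErr P W f α π x₀ t l
      + 16 / δ * α t ^ 2 * (L ^ 2 * trackErr P W f α π x₀ xs t l
        + L ^ 2 * (α t ^ 2 * (m * sigmaSq f xs)) + sigmaSq f xs) := by
  have hint := integrable_epoch hπ W f α x₀ t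
  refine le_trans (integral_mono (hint fun σ x => consErr (innerIter W f (α t) σ x (l + 1)) / n)
    (hint fun σ x => (1 - δ / 2) * (consErr (innerIter W f (α t) σ x l) / n)
      + 16 / δ * α t ^ 2 * (L ^ 2 * ‖avg (innerIter W f (α t) σ x l) - shadow f (α t) σ xs l‖ ^ 2
        + L ^ 2 * ‖shadow f (α t) σ xs l - xs‖ ^ 2
        + 1 / (n : ℝ) * ∑ i, ‖gradient (f i (σ i ⟨l, hl⟩)) xs‖ ^ 2)) fun ω => ?_) ?_
  · dsimp only
    rw [innerIter_succ _ _ _ _ _ hl]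
    exact consErr_step_le hn hW hδ hδ0 hαL (fun i => hf i _) _ _ _
  · have hc : 0 ≤ 16 / δ * α t ^ 2 := by positivity
    rw [integral_add (hint fun σ x => (1 - δ / 2) * (consErr (innerIter W f (α t) σ x l) / n))
      (hint fun σ x => 16 / δ * α t ^ 2 *
        (L ^ 2 * ‖avg (innerIter W f (α t) σ x l) - shadow f (α t) σ xs l‖ ^ 2
        + L ^ 2 * ‖shadow f (α t) σ xs l - xs‖ ^ 2
        + 1 / (n : ℝ) * ∑ i, ‖gradient (f i (σ i ⟨l, hl⟩)) xs‖ ^ 2)),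
      integral_const_mul, integral_const_mul,
      integral_add (hint fun σ x =>
        L ^ 2 * ‖avg (innerIter W f (α t) σ x l) - shadow f (α t) σ xs l‖ ^ 2
        + L ^ 2 * ‖shadow f (α t) σ xs l - xs‖ ^ 2)
      (hint fun σ _ => 1 / (n : ℝ) * ∑ i, ‖gradient (f i (σ i ⟨l, hl⟩)) xs‖ ^ 2),
      integral_add (hint fun σ x =>
        L ^ 2 * ‖avg (innerIter W f (α t) σ x l) - shadow f (α t) σ xs l‖ ^ 2)
      (hint fun σ _ => L ^ 2 * ‖shadow f (α t) σ xs l - xs‖ ^ 2), integral_const_mul,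
      integral_const_mul, integral_gradient_sq_eq hn hm hπ f xs t ⟨l, hl⟩]
    have := integral_norm_shadow_sub_sq_le hn hm hπ (α t) h0 t l
    simp only [trackErr, meanConsErr]
    gcongr

end Shadow

/-! ### Solving the coupled recursions -/

section Recursion

/-- One step of the coupled recursions keeps the Lyapunov function `a + 16 k₀ b` below any bound
that dominates both its current value and the noise level. -/
lemma lyapunov_step {r k k₀ δ m c a b a' b' X : ℝ} (hr : 0 ≤ r) (hk : 0 ≤ k) (hk₀ : k ≤ k₀)
    (hk₁ : k₀ ≤ 1 / 40) (hδ : 0 < δ) (hδ1 : δ ≤ 1) (hrk : r ≤ k * δ) (hm : 1 ≤ m) (hc : 0 ≤ c)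
    (ha : 0 ≤ a) (hb : 0 ≤ b) (hX : 28 * (m * c) ≤ X) (hab : a + 16 * k₀ * b ≤ X)
    (ha' : a' ≤ (1 - r) * a + 4 * (k * δ) * (r * (k * δ) * (m * c) + b))
    (hb' : b' ≤ (1 - δ / 2) * b + 16 * (r * k) * (a + r * (k * δ) * (m * c) + c)) :
    a' + 16 * k₀ * b' ≤ X := by
  have hk0' : 0 ≤ k₀ := hk.trans hk₀
  have hmc : 0 ≤ m * c := by positivity
  have hcm : c ≤ m * c := le_mul_of_one_le_left hc hm
  have hkδ : k * δ ≤ 1 / 40 := by nlinarith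
  have hkδ0 : 0 ≤ k * δ := by positivity
  have hrδ : r ≤ δ / 40 := by nlinarith
  have hkk : 16 * k₀ * (16 * k) ≤ 16 / 100 := by nlinarith
  have hkδ2 : (k * δ) * (k * δ) ≤ 1 / 1600 := by nlinarith
  have hrkδ : r * (k * δ) ≤ 1 := by nlinarith
  -- the noise entering through the shadow sequence
  have h1 : 4 * (k * δ) * (r * (k * δ) * (m * c)) ≤ r * (m * c / 400) := by
    have := mul_le_mul_of_nonneg_right hkδ2 (mul_nonneg hr hmc)
    linarith
  have h2 : 4 * (k * δ) * b ≤ 16 * k₀ * (δ / 4) * b := by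
    have : k * δ * b ≤ k₀ * δ * b := by gcongr
    linarith
  have h3 : 16 * k₀ * (16 * (r * k) * (a + r * (k * δ) * (m * c) + c))
      ≤ 16 / 100 * (r * (a + 2 * (m * c))) := by
    have e : r * (k * δ) * (m * c) ≤ m * c := mul_le_of_le_one_left hmc hrkδ
    have h0 : 0 ≤ r * (a + r * (k * δ) * (m * c) + c) := by positivity
    calc _ = 16 * k₀ * (16 * k) * (r * (a + r * (k * δ) * (m * c) + c)) := by ring
      _ ≤ 16 / 100 * (r * (a + r * (k * δ) * (m * c) + c)) := mul_le_mul_of_nonneg_right hkk h0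
      _ ≤ _ := by
        have : r * (a + r * (k * δ) * (m * c) + c) ≤ r * (a + 2 * (m * c)) :=
          mul_le_mul_of_nonneg_left (by linarith) hr
        linarith
  have h4 : 16 * k₀ * (r / 2) * b ≤ 16 * k₀ * (δ / 4) * b := by
    have : r / 2 ≤ δ / 4 := by linarith
    gcongr
  have h5 : r / 2 * (a + 16 * k₀ * b) + r / 2 * (28 * (m * c))
      ≤ r / 2 * (a + 16 * k₀ * b) + r / 2 * X := by gcongr
  have h6 : (1 - r / 2) * (a + 16 * k₀ * b) ≤ (1 - r / 2) * X :=
    mul_le_mul_of_nonneg_left hab (by linarith)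
  have h7 : 16 * k₀ * b'
      ≤ 16 * k₀ * ((1 - δ / 2) * b + 16 * (r * k) * (a + r * (k * δ) * (m * c) + c)) :=
    mul_le_mul_of_nonneg_left hb' (by linarith)
  have h8 : 0 ≤ r * (m * c) := by positivity
  have h9 : 0 ≤ r * a := by positivity
  linarith

/-- The geometric decay over an epoch is faster than the decay of the squared stepsizes. -/
lemma one_add_pow_le_two_mul_sq {δ τ : ℝ} {m : ℕ} (hm : 0 < m) (hδ : 0 < δ) (hδ1 : δ ≤ 1)
    (hτ : 6 ≤ τ) (hτ2 : 24 / (m * δ) ≤ τ) :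
    1 + (1 - δ / 2) ^ m ≤ 2 * (τ / (τ + 1)) ^ 2 := by
  have hm' : (0 : ℝ) < m := by positivity
  set y : ℝ := m * δ with hy
  have hy0 : 0 < y := by positivity
  have hq : (1 - δ / 2) ^ m ≤ 1 / (1 + y / 2) := by
    have h1 := one_add_mul_le_pow (show (-2 : ℝ) ≤ δ / 2 by linarith) m
    have h2 : (1 - δ / 2) ^ m * (1 + δ / 2) ^ m ≤ 1 := by
      rw [← mul_pow]
      exact pow_le_one₀ (by nlinarith) (by nlinarith)
    rw [le_div_iff₀ (by positivity)]
    refine le_trans (mul_le_mul_of_nonneg_left ?_ (by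
      have : 0 ≤ 1 - δ / 2 := by linarith
      positivity)) h2
    rw [hy]
    linarith
  have h3 : (1 : ℝ) - 2 / (τ + 1) ≤ (τ / (τ + 1)) ^ 2 := by
    have : (τ / (τ + 1)) = 1 - 1 / (τ + 1) := by field_simp; ring
    rw [this]
    have : 2 / (τ + 1) = 2 * (1 / (τ + 1)) := by ring
    nlinarith [sq_nonneg (1 / (τ + 1))]
  -- one third of `τ ≥ 24 / y` plus two thirds of `τ ≥ 6` gives `τ ≥ 8 / y + 4`
  have h4 : 2 / (τ + 1) ≤ (1 - 1 / (1 + y / 2)) / 2 := by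
    have e : (1 - 1 / (1 + y / 2)) / 2 = y / (4 + 2 * y) := by field_simp; ring
    rw [e, div_le_div_iff₀ (by linarith) (by positivity)]
    rw [div_le_iff₀ hy0] at hτ2
    nlinarith
  linarith

lemma exp_mul_rpow_le {θ K τ : ℝ} (hθ : 0 < θ) (hK : 0 < K) (hτ : 0 < τ) :
    Real.exp (-(θ / τ)) * (K / τ) ^ (θ / 2) ≤ (K / (τ + 1)) ^ (θ / 2) := by
  have e : K / (τ + 1) = τ / (τ + 1) * (K / τ) := by field_simp
  rw [e, Real.mul_rpow (by positivity) (by positivity)]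
  refine mul_le_mul_of_nonneg_right ?_ (by positivity)
  have h1 : Real.exp (-(1 / τ)) ≤ τ / (τ + 1) := by
    have h := Real.add_one_le_exp (1 / τ)
    rw [Real.exp_neg, inv_le_comm₀ (Real.exp_pos _) (by positivity), inv_div]
    refine le_trans (le_of_eq ?_) h
    field_simp
    ring
  calc Real.exp (-(θ / τ)) ≤ Real.exp (-(1 / τ) * (θ / 2)) := by
        refine Real.exp_le_exp.2 ?_
        have : 0 ≤ θ / τ := by positivity
        have e2 : -(1 / τ) * (θ / 2) = -(θ / τ / 2) := by ring
        rw [e2]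
        linarith
    _ = Real.exp (-(1 / τ)) ^ (θ / 2) := Real.exp_mul _ _
    _ ≤ _ := Real.rpow_le_rpow (Real.exp_pos _).le h1 (by linarith)

lemma exp_mul_div_sq_add_le {θ τ M N : ℝ} (hθ : 12 < θ) (hτ : θ / 2 ≤ τ) (hM : 0 ≤ M)
    (hN : N ≤ M * ((θ - 4) / 4)) :
    Real.exp (-(θ / τ)) * (M / τ ^ 2) + N / τ ^ 3 ≤ M / (τ + 1) ^ 2 := by
  have hτ0 : 0 < τ := by linarith
  have h1 : Real.exp (-(θ / τ)) ≤ 1 - θ / 3 / τ := by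
    have h := Real.add_one_le_exp (θ / τ)
    have h2 : Real.exp (-(θ / τ)) ≤ τ / (τ + θ) := by
      rw [Real.exp_neg, inv_le_comm₀ (Real.exp_pos _) (by positivity), inv_div]
      refine le_trans (le_of_eq ?_) h
      field_simp
      ring
    refine h2.trans ?_
    have e : τ / (τ + θ) = 1 - θ / (τ + θ) := by field_simp; ring
    rw [e, div_div]
    have : θ / (3 * τ) ≤ θ / (τ + θ) := by
      apply div_le_div_of_nonneg_left <;> linarith
    linarith
  have h2 : 1 - 2 / τ ≤ τ ^ 2 / (τ + 1) ^ 2 := by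
    rw [le_div_iff₀ (by positivity), one_sub_div hτ0.ne', div_mul_eq_mul_div, div_le_iff₀ hτ0]
    nlinarith
  have h3 : 1 - θ / 3 / τ + (θ - 4) / 4 / τ ≤ 1 - 2 / τ := by
    have : (θ / 3 - (θ - 4) / 4) / τ ≥ 2 / τ := by
      apply div_le_div_of_nonneg_right _ hτ0.le
      linarith
    rw [sub_div] at this
    linarith
  have h4 : N / τ ^ 3 ≤ M / τ ^ 2 * ((θ - 4) / 4 / τ) := by
    have e : M / τ ^ 2 * ((θ - 4) / 4 / τ) = M * ((θ - 4) / 4) / τ ^ 3 := by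
      field_simp
    rw [e]
    gcongr
  have hMτ : 0 ≤ M / τ ^ 2 := by positivity
  calc Real.exp (-(θ / τ)) * (M / τ ^ 2) + N / τ ^ 3
      ≤ (1 - θ / 3 / τ) * (M / τ ^ 2) + M / τ ^ 2 * ((θ - 4) / 4 / τ) :=
        add_le_add (mul_le_mul_of_nonneg_right h1 hMτ) h4
    _ = M / τ ^ 2 * (1 - θ / 3 / τ + (θ - 4) / 4 / τ) := by ring
    _ ≤ M / τ ^ 2 * (τ ^ 2 / (τ + 1) ^ 2) := mul_le_mul_of_nonneg_left (h3.trans h2) hMτ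
    _ = M / (τ + 1) ^ 2 := by field_simp

/-- Induction over the steps of all epochs. -/
lemma epoch_induction {m : ℕ} {Q : ℕ → ℕ → Prop} (h0 : Q 0 0)
    (hstep : ∀ t l, l < m → Q t l → Q t (l + 1)) (hnext : ∀ t, Q t m → Q (t + 1) 0)
    (t : ℕ) {l : ℕ} (hl : l ≤ m) : Q t l := by
  have inner : ∀ t, Q t 0 → ∀ l, l ≤ m → Q t l := fun t ht l => by
    induction l with
    | zero => exact fun _ => ht
    | succ l ih => exact fun h => hstep t l h (ih (Nat.le_of_succ_le h))
  have outer : ∀ t, Q t 0 := fun t => by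
    induction t with
    | zero => exact h0
    | succ t ih => exact hnext t (inner t ih m le_rfl)
  exact inner t (outer t) l hl

/-- The coupled recursions of the tracking error `a` and the consensus error `b` in normalised
form: `r t = α_t μ` is the stepsize measured in units of `1/μ`, `κ = L² / (μ² δ)`, and `c` plays
the role of `σ_*² / L²`. -/
structure ErrorRecursion (m : ℕ) (θ K δ κ c : ℝ) (r : ℕ → ℝ) (a b : ℕ → ℕ → ℝ) : Prop where
  m_pos : 0 < m
  theta_gt : 12 < θ
  delta_pos : 0 < δ
  delta_le : δ ≤ 1
  kappa_ge : 1 ≤ κ * δ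
  c_nonneg : 0 ≤ c
  r_eq : ∀ t, r t = θ / (m * (t + K))
  K_ge_half : θ / 2 ≤ K
  K_ge_delta : 2 * θ / (m * δ) ≤ K
  kappa_r_le : κ * r 0 ≤ 1 / 40
  a_nonneg : ∀ t l, 0 ≤ a t l
  b_nonneg : ∀ t l, 0 ≤ b t l
  a_epoch : ∀ t, a (t + 1) 0 = a t m
  b_epoch : ∀ t, b (t + 1) 0 = b t m
  a_succ : ∀ t l, l < m → a t (l + 1) ≤ (1 - r t) * a t l
    + 4 * (κ * r t * δ) * (r t * (κ * r t * δ) * (m * c) + b t l)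
  b_succ : ∀ t l, l < m → b t (l + 1) ≤ (1 - δ / 2) * b t l
    + 16 * (r t * (κ * r t)) * (a t l + r t * (κ * r t * δ) * (m * c) + c)

namespace ErrorRecursion

variable {m : ℕ} {θ K δ κ c X Y : ℝ} {r : ℕ → ℝ} {a b : ℕ → ℕ → ℝ}

lemma tau_ge (h : ErrorRecursion m θ K δ κ c r a b) (t : ℕ) : θ / 2 ≤ t + K := by
  have := h.K_ge_half
  have : (0 : ℝ) ≤ t := Nat.cast_nonneg t
  linarith

lemma tau_pos (h : ErrorRecursion m θ K δ κ c r a b) (t : ℕ) : 0 < (t : ℝ) + K := by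
  have := h.tau_ge t
  have := h.theta_gt
  linarith

lemma kappa_pos (h : ErrorRecursion m θ K δ κ c r a b) : 0 < κ := by
  by_contra hneg
  have := h.kappa_ge
  nlinarith [h.delta_pos]

lemma r_pos (h : ErrorRecursion m θ K δ κ c r a b) (t : ℕ) : 0 < r t := by
  have := h.tau_pos t
  have := h.theta_gt
  have := h.m_pos
  rw [h.r_eq]
  positivity

lemma r_le (h : ErrorRecursion m θ K δ κ c r a b) (t : ℕ) : r t ≤ r 0 := by
  have h0 := h.tau_pos 0
  have hm : (0 : ℝ) < m := by exact_mod_cast h.m_pos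
  have := h.theta_gt
  rw [h.r_eq, h.r_eq]
  push_cast at h0 ⊢
  gcongr
  linarith

lemma kappa_r_le' (h : ErrorRecursion m θ K δ κ c r a b) (t : ℕ) : κ * r t ≤ 1 / 40 :=
  (mul_le_mul_of_nonneg_left (h.r_le t) h.kappa_pos.le).trans h.kappa_r_le

lemma r_le_kappa (h : ErrorRecursion m θ K δ κ c r a b) (t : ℕ) : r t ≤ κ * r t * δ := by
  nlinarith [h.kappa_ge, h.r_pos t]

lemma r_le_delta (h : ErrorRecursion m θ K δ κ c r a b) (t : ℕ) : r t ≤ δ / 40 := by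
  nlinarith [h.r_le_kappa t, h.kappa_r_le' t, h.delta_pos]

/-- The tracking error stays bounded. -/
lemma a_le (h : ErrorRecursion m θ K δ κ c r a b) (hX : 28 * (m * c) ≤ X)
    (h0 : a 0 0 + 16 * (κ * r 0) * b 0 0 ≤ X) (t : ℕ) {l : ℕ} (hl : l ≤ m) : a t l ≤ X := by
  have hm : (1 : ℝ) ≤ m := by exact_mod_cast h.m_pos
  have hk0 : 0 ≤ κ * r 0 := mul_nonneg h.kappa_pos.le (h.r_pos 0).le
  have key : a t l + 16 * (κ * r 0) * b t l ≤ X := by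
    refine epoch_induction (Q := fun t l => a t l + 16 * (κ * r 0) * b t l ≤ X) h0 ?_ ?_ t hl
    · intro t l hl hab
      exact lyapunov_step (h.r_pos t).le (mul_nonneg h.kappa_pos.le (h.r_pos t).le)
        (mul_le_mul_of_nonneg_left (h.r_le t) h.kappa_pos.le) h.kappa_r_le h.delta_pos h.delta_le
        (h.r_le_kappa t) hm h.c_nonneg (h.a_nonneg t l) (h.b_nonneg t l) hX hab
        (h.a_succ t l hl) (h.b_succ t l hl)
    · intro t hab
      simpa only [h.a_epoch, h.b_epoch] using hab
  have := mul_nonneg (mul_nonneg (by norm_num : (0 : ℝ) ≤ 16) hk0) (h.b_nonneg t l)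
  linarith

lemma shadow_noise_le (h : ErrorRecursion m θ K δ κ c r a b) (t : ℕ) :
    r t * (κ * r t * δ) ≤ 1 := by
  have h1 := h.r_le_delta t
  have h2 := h.kappa_r_le' t
  have := h.delta_le
  have := h.delta_pos
  have := (h.r_pos t).le
  have h3 : κ * r t * δ ≤ 1 := by nlinarith
  nlinarith

/-- With a bounded tracking error, the noise in the consensus recursion is of order `r t ^ 2`. -/
lemma b_succ_le (h : ErrorRecursion m θ K δ κ c r a b) (hX : 28 * (m * c) ≤ X)
    (h0 : a 0 0 + 16 * (κ * r 0) * b 0 0 ≤ X) (hY : 30 * (κ * X) ≤ Y) (t l : ℕ) (hl : l < m) :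
    b t (l + 1) ≤ (1 - δ / 2) * b t l + r t ^ 2 * Y := by
  refine (h.b_succ t l hl).trans ?_
  have hm : (1 : ℝ) ≤ m := by exact_mod_cast h.m_pos
  have ha := h.a_le hX h0 t hl.le
  have hc := h.c_nonneg
  have hcm : c ≤ m * c := le_mul_of_one_le_left hc hm
  have h1 : r t * (κ * r t * δ) * (m * c) ≤ m * c :=
    mul_le_of_le_one_left (by positivity) (h.shadow_noise_le t)
  have hrk : 0 ≤ r t ^ 2 * κ := mul_nonneg (sq_nonneg _) h.kappa_pos.le
  have h2 : 16 * (a t l + r t * (κ * r t * δ) * (m * c) + c) ≤ 30 * X := by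
    have : 0 ≤ X := (h.a_nonneg t l).trans ha
    linarith
  have h3 := mul_le_mul_of_nonneg_left h2 hrk
  have h4 := mul_le_mul_of_nonneg_left hY (sq_nonneg (r t))
  linarith

/-- The consensus error: geometric decay of the initial error plus a term of the order of the
squared stepsize. The two parts of the noise term track the initial error of the epoch and the
noise accumulated within it. -/
lemma b_le (h : ErrorRecursion m θ K δ κ c r a b) (hX : 28 * (m * c) ≤ X)
    (h0 : a 0 0 + 16 * (κ * r 0) * b 0 0 ≤ X) (hY : 30 * (κ * X) ≤ Y) (t : ℕ) {l : ℕ}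
    (hl : l ≤ m) :
    b t l ≤ (1 - δ / 2) ^ (m * t + l) * b 0 0
      + 2 / δ * (1 + (1 - δ / 2) ^ l) * (r t ^ 2 * Y) := by
  have hδ := h.delta_pos
  have hδ1 := h.delta_le
  have hm0 : (0 : ℝ) < m := by exact_mod_cast h.m_pos
  have hX0 : 0 ≤ X := (h.a_nonneg 0 0).trans (h.a_le hX h0 0 (Nat.zero_le _))
  have hκ := h.kappa_pos
  have hY0 : 0 ≤ Y := le_trans (by positivity) hY
  refine epoch_induction (m := m) (Q := fun t l => b t l ≤ (1 - δ / 2) ^ (m * t + l) * b 0 0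
      + 2 / δ * (1 + (1 - δ / 2) ^ l) * (r t ^ 2 * Y)) ?_ ?_ ?_ t hl
  · simp only [mul_zero, add_zero, pow_zero, one_mul]
    exact le_add_of_nonneg_right (by positivity)
  · intro t l hl hb
    refine (h.b_succ_le hX h0 hY t l hl).trans ?_
    have h1 := mul_le_mul_of_nonneg_left hb (by linarith : (0 : ℝ) ≤ 1 - δ / 2)
    have e : (1 - δ / 2) * ((1 - δ / 2) ^ (m * t + l) * b 0 0
        + 2 / δ * (1 + (1 - δ / 2) ^ l) * (r t ^ 2 * Y)) + r t ^ 2 * Y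
        = (1 - δ / 2) ^ (m * t + (l + 1)) * b 0 0
        + 2 / δ * (1 + (1 - δ / 2) ^ (l + 1)) * (r t ^ 2 * Y) := by
      rw [← add_assoc, pow_succ, pow_succ]
      field_simp
      ring
    linarith
  · intro t hb
    rw [h.b_epoch]
    refine hb.trans ?_
    have e : m * (t + 1) + 0 = m * t + m := by ring
    rw [e, pow_zero]
    have hτ := h.tau_pos t
    have hr : r (t + 1) = ((t + K) / (t + K + 1)) * r t := by
      have hτ1 : (t : ℝ) + 1 + K ≠ 0 := by linarith
      have hτ2 : (t : ℝ) + K + 1 ≠ 0 := by linarith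
      rw [h.r_eq, h.r_eq]
      push_cast
      field_simp
      ring
    have h1 := one_add_pow_le_two_mul_sq (τ := t + K) h.m_pos hδ hδ1
      (by linarith [h.tau_ge t, h.theta_gt]) (by
        have h2 : 24 / (m * δ) ≤ 2 * θ / (m * δ) := by
          have := h.theta_gt
          gcongr
          linarith
        have := h.K_ge_delta
        have : (0 : ℝ) ≤ t := Nat.cast_nonneg t
        linarith)
    rw [hr, mul_pow]
    have h2 : 0 ≤ 2 / δ * (r t ^ 2 * Y) := by positivity
    have h3 := mul_le_mul_of_nonneg_right h1 h2
    linarith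

lemma b_le_four (h : ErrorRecursion m θ K δ κ c r a b) (hX : 28 * (m * c) ≤ X)
    (h0 : a 0 0 + 16 * (κ * r 0) * b 0 0 ≤ X) (hY : 30 * (κ * X) ≤ Y) (t : ℕ) {l : ℕ}
    (hl : l ≤ m) :
    b t l ≤ (1 - δ / 2) ^ (m * t + l) * b 0 0 + 4 / δ * (r t ^ 2 * Y) := by
  refine (h.b_le hX h0 hY t hl).trans ?_
  have hδ := h.delta_pos
  have hδ1 := h.delta_le
  have hX0 : 0 ≤ X := (h.a_nonneg 0 0).trans (h.a_le hX h0 0 (Nat.zero_le _))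
  have hκ := h.kappa_pos
  have hY0 : 0 ≤ Y := le_trans (by positivity) hY
  have h1 : (1 - δ / 2) ^ l ≤ 1 := pow_le_one₀ (by linarith) (by linarith)
  have h2 : 0 ≤ 2 / δ * (r t ^ 2 * Y) := by positivity
  have h3 := mul_le_mul_of_nonneg_left h1 h2
  have e : 4 / δ * (r t ^ 2 * Y) = 2 * (2 / δ * (r t ^ 2 * Y)) := by ring
  rw [e]
  linarith

/-- Within an epoch, the tracking error augmented by a multiple of the geometrically decaying part
of the consensus error contracts by `1 - r t` in each step, up to noise of order `r t ^ 3`. -/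
lemma a_add_le (h : ErrorRecursion m θ K δ κ c r a b) (hX : 28 * (m * c) ≤ X)
    (h0 : a 0 0 + 16 * (κ * r 0) * b 0 0 ≤ X) (hY : 30 * (κ * X) ≤ Y) (t : ℕ) (l : ℕ)
    (hl : l ≤ m) :
    a t l + 96 * κ * ((1 - δ / 2) ^ (m * t + l) * b 0 0)
      ≤ (1 - r t) ^ l * (a t 0 + 96 * κ * ((1 - δ / 2) ^ (m * t) * b 0 0))
        + l * (20 * κ * r t ^ 3 * Y) := by
  have hδ := h.delta_pos
  have hδ1 := h.delta_le
  have hX0 : 0 ≤ X := (h.a_nonneg 0 0).trans (h.a_le hX h0 0 (Nat.zero_le _))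
  have hκ := h.kappa_pos
  have hY0 : 0 ≤ Y := le_trans (by positivity) hY
  have hr := h.r_pos t
  have hrδ := h.r_le_delta t
  have hm0 : (0 : ℝ) < m := by exact_mod_cast h.m_pos
  have hc := h.c_nonneg
  induction l with
  | zero => simp
  | succ l ih =>
    have ih' := ih (Nat.le_of_succ_le hl)
    set y := (1 - δ / 2) ^ (m * t + l) * b 0 0 with hy
    have hy0 : 0 ≤ y := by
      have : 0 ≤ 1 - δ / 2 := by linarith
      have := h.b_nonneg 0 0
      positivity
    have ey : (1 - δ / 2) ^ (m * t + (l + 1)) * b 0 0 = (1 - δ / 2) * y := by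
      rw [hy, ← add_assoc, pow_succ]; ring
    have hb := h.b_le_four hX h0 hY t (Nat.le_of_succ_le hl)
    rw [← hy] at hb
    have ha := h.a_succ t l hl
    have hmc : κ * (m * c) ≤ Y := by nlinarith
    have hnoise : r t * (κ * r t * δ) * (m * c) + b t l ≤ y + 5 / δ * (r t ^ 2 * Y) := by
      have e1 : r t * (κ * r t * δ) * (m * c) ≤ 1 / δ * (r t ^ 2 * Y) := by
        have h1 : r t ^ 2 * δ * (κ * (m * c)) ≤ r t ^ 2 * δ * Y :=
          mul_le_mul_of_nonneg_left hmc (by positivity)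
        have h2 : δ * (r t ^ 2 * Y) ≤ 1 / δ * (r t ^ 2 * Y) := by
          refine mul_le_mul_of_nonneg_right ?_ (by positivity)
          rw [le_div_iff₀ hδ]
          nlinarith
        linarith
      have e2 : 5 / δ * (r t ^ 2 * Y) = 4 / δ * (r t ^ 2 * Y) + 1 / δ * (r t ^ 2 * Y) := by ring
      linarith
    have h4 : 4 * (κ * r t * δ) * (r t * (κ * r t * δ) * (m * c) + b t l)
        ≤ 4 * κ * δ * r t * y + 20 * κ * r t ^ 3 * Y := by
      refine (mul_le_mul_of_nonneg_left hnoise (by positivity)).trans (le_of_eq ?_)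
      field_simp
      ring
    -- the decay of the added multiple pays for the geometric part of the consensus error
    have h5 : 4 * κ * δ * r t * y + 96 * κ * ((1 - δ / 2) * y) ≤ (1 - r t) * (96 * κ * y) := by
      have : 4 * δ * r t + 96 * r t ≤ 48 * δ := by nlinarith
      have := mul_le_mul_of_nonneg_right this (mul_nonneg hκ.le hy0)
      linarith
    have h6 := mul_le_mul_of_nonneg_left ih' (by linarith : 0 ≤ 1 - r t)
    have h7 : (1 - r t) * (l * (20 * κ * r t ^ 3 * Y)) ≤ l * (20 * κ * r t ^ 3 * Y) := by
      have : 0 ≤ (l : ℝ) * (20 * κ * r t ^ 3 * Y) := by positivity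
      nlinarith
    rw [ey, pow_succ]
    push_cast
    linarith

/-- The tracking error at the beginning of an epoch. -/
lemma a_zero_le (h : ErrorRecursion m θ K δ κ c r a b) (hX : 28 * (m * c) ≤ X)
    (h0 : a 0 0 + 16 * (κ * r 0) * b 0 0 ≤ X) (hY : 30 * (κ * X) ≤ Y) (t : ℕ) :
    a t 0 ≤ (K / (t + K)) ^ (θ / 2) * (a 0 0 + 96 * κ * b 0 0)
      + 96 * θ ^ 3 * κ * Y / (m ^ 2 * δ * (θ - 4)) / (t + K) ^ 2 := by
  have hδ := h.delta_pos
  have hδ1 := h.delta_le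
  have hX0 : 0 ≤ X := (h.a_nonneg 0 0).trans (h.a_le hX h0 0 (Nat.zero_le _))
  have hκ := h.kappa_pos
  have hY0 : 0 ≤ Y := le_trans (by positivity) hY
  have hm0 : (0 : ℝ) < m := by exact_mod_cast h.m_pos
  have hθ := h.theta_gt
  have hθ4 : 0 < θ - 4 := by linarith
  have hb0 := h.b_nonneg 0 0
  have ha0 := h.a_nonneg 0 0
  have hK : 0 < K := by simpa using h.tau_pos 0
  set M := 96 * θ ^ 3 * κ * Y / (m ^ 2 * δ * (θ - 4)) with hM
  have hM0 : 0 ≤ M := by positivity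
  set G₀ := a 0 0 + 96 * κ * b 0 0 with hG₀
  have hG0 : 0 ≤ G₀ := by positivity
  have hy0 : ∀ k, 0 ≤ 96 * κ * ((1 - δ / 2) ^ k * b 0 0) := fun k => by
    have : 0 ≤ 1 - δ / 2 := by linarith
    positivity
  suffices hG : a t 0 + 96 * κ * ((1 - δ / 2) ^ (m * t) * b 0 0)
      ≤ (K / (t + K)) ^ (θ / 2) * G₀ + M / (t + K) ^ 2 by
    linarith [hy0 (m * t)]
  induction t with
  | zero =>
    have : (K / K) ^ (θ / 2) = 1 := by rw [div_self hK.ne', Real.one_rpow]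
    simp only [Nat.cast_zero, zero_add, mul_zero, pow_zero, one_mul, this]
    exact le_add_of_nonneg_right (by positivity)
  | succ t ih =>
    have hτ := h.tau_pos t
    have hr := h.r_pos t
    have hrδ := h.r_le_delta t
    have h1 := h.a_add_le hX h0 hY t m le_rfl
    rw [h.a_epoch, mul_add, mul_one]
    refine h1.trans ?_
    have hexp : (1 - r t) ^ m ≤ Real.exp (-(θ / (t + K))) := by
      have e : -(θ / (t + K)) = m * (-r t) := by
        rw [h.r_eq]; field_simp
      rw [e, Real.exp_nat_mul]
      refine pow_le_pow_left₀ (by linarith) ?_ m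
      linarith [Real.add_one_le_exp (-r t)]
    have hN : (m : ℝ) * (20 * κ * r t ^ 3 * Y) = 20 * κ * θ ^ 3 * Y / m ^ 2 / (t + K) ^ 3 := by
      rw [h.r_eq]
      field_simp
    have hNM : 20 * κ * θ ^ 3 * Y / m ^ 2 ≤ M * ((θ - 4) / 4) := by
      have e : M * ((θ - 4) / 4) = 24 * κ * θ ^ 3 * Y / m ^ 2 / δ := by
        rw [hM]; field_simp; ring
      rw [e, le_div_iff₀ hδ]
      have h2 : 0 ≤ κ * θ ^ 3 * Y / m ^ 2 := by positivity
      have e2 : 20 * κ * θ ^ 3 * Y / m ^ 2 = 20 * (κ * θ ^ 3 * Y / m ^ 2) := by ring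
      have e3 : 24 * κ * θ ^ 3 * Y / m ^ 2 = 24 * (κ * θ ^ 3 * Y / m ^ 2) := by ring
      rw [e2, e3]
      nlinarith
    have h3 := exp_mul_rpow_le (θ := θ) (by linarith) hK hτ
    have h4 := exp_mul_div_sq_add_le hθ (h.tau_ge t) hM0 hNM
    have h5 : (1 - r t) ^ m * (a t 0 + 96 * κ * ((1 - δ / 2) ^ (m * t) * b 0 0))
        ≤ Real.exp (-(θ / (t + K))) * ((K / (t + K)) ^ (θ / 2) * G₀ + M / (t + K) ^ 2) :=
      mul_le_mul hexp ih (add_nonneg (h.a_nonneg t 0) (hy0 _)) (Real.exp_pos _).le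
    have h6 := mul_le_mul_of_nonneg_right h3 hG0
    have e : ((t + 1 : ℕ) : ℝ) + K = t + K + 1 := by push_cast; ring
    rw [e, hN]
    linarith

end ErrorRecursion

end Recursion

/-! ### The bounds for D-RR -/

section Bounds

open MeasureTheory Filter Topology

variable {n m p : ℕ} {μ L θ K : ℝ}

lemma sigmaSq_nonneg (f : Fin n → Fin m → Vec p → ℝ) (xs : Vec p) : 0 ≤ sigmaSq f xs := by
  unfold sigmaSq
  positivity

/-- In positive dimension the strong convexity modulus is at most the smoothness constant. -/
lemma IsStronglyConvexSmooth.le (hp : 0 < p) {f : Vec p → ℝ} (hf : IsStronglyConvexSmooth μ L f) :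
    μ ≤ L := by
  set e : Vec p := EuclideanSpace.single ⟨0, hp⟩ 1 with he
  have hn : ‖e - 0‖ = 1 := by simp [he]
  have h1 := hf.strong e 0
  have h2 := hf.smooth e 0
  have h3 := real_inner_le_norm (gradient f e - gradient f 0) (e - 0)
  rw [hn] at h1 h2 h3
  linarith

lemma half_le_of_Kmin_le {ρ : ℝ} (hK : Kmin m θ μ L ρ ≤ K) : θ / 2 ≤ K :=
  ((le_max_left _ _).trans (le_max_left _ _)).trans hK

lemma two_mul_div_le_of_Kmin_le {ρ : ℝ} (hK : Kmin m θ μ L ρ ≤ K) :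
    2 * θ / (m * (1 - ρ ^ 2)) ≤ K :=
  ((le_max_left _ _).trans (le_max_right _ _)).trans hK

lemma sq_div_le_of_Kmin_le {ρ : ℝ} (hK : Kmin m θ μ L ρ ≤ K) :
    8 * √30 * L ^ 2 * θ / ((1 - ρ ^ 2) * m * μ ^ 2) ≤ K :=
  ((le_max_right _ _).trans (le_max_right _ _)).trans hK

variable {Ω : Type*} [MeasurableSpace Ω] {P : Measure Ω} [IsProbabilityMeasure P]
  {G : SimpleGraph (Fin n)} {W : Matrix (Fin n) (Fin n) ℝ} {f : Fin n → Fin m → Vec p → ℝ}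
  {xs : Vec p} {π : ℕ → Fin n → Ω → Equiv.Perm (Fin m)} {x₀ : Fin n → Vec p}

/-- The expected errors of D-RR satisfy the normalised recursions. -/
lemma errorRecursion (hp : 0 < p) (hn : 0 < n) (hm : 0 < m) (hW : IsMixingMatrix G W)
    (hρ : rhoW W < 1) (hμ : 0 < μ) (hf : ∀ i l, IsStronglyConvexSmooth μ L (f i l))
    (hxs : IsMinOn (objective f) Set.univ xs) (hπ : IsUniformReshuffling P π)
    (hθ : 12 < θ) (hK : Kmin m θ μ L (rhoW W) ≤ K) :
    ErrorRecursion m θ K (1 - rhoW W ^ 2) (L ^ 2 / (μ ^ 2 * (1 - rhoW W ^ 2)))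
      (sigmaSq f xs / L ^ 2) (fun t => stepsize m θ μ K t * μ)
      (trackErr P W f (stepsize m θ μ K) π x₀ xs)
      (meanConsErr P W f (stepsize m θ μ K) π x₀) := by
  have hμL : μ ≤ L := (hf ⟨0, hn⟩ ⟨0, hm⟩).le hp
  have hL : 0 < L := hμ.trans_le hμL
  have hρ0 := rhoW_nonneg W
  set δ := 1 - rhoW W ^ 2 with hδ
  have hδ0 : 0 < δ := by rw [hδ]; nlinarith
  have hδ1 : δ ≤ 1 := by rw [hδ]; nlinarith
  have hm' : (0 : ℝ) < m := by positivity
  have hKθ := half_le_of_Kmin_le hK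
  have hK0 : 0 < K := by linarith
  have h0 := sum_gradient_eq_zero hn hm (fun i l => (hf i l).differentiable) hxs
  have hαpos : ∀ t, 0 < stepsize m θ μ K t := fun t => by
    have : 0 < θ := by linarith
    unfold stepsize
    positivity
  have hα0 : ∀ t, stepsize m θ μ K t ≤ stepsize m θ μ K 0 := fun t => by
    have : 0 < θ := by linarith
    unfold stepsize
    gcongr
    simp
  -- the last lower bound on `K`, with `8 √30 ≥ 40`
  have hα40 : stepsize m θ μ K 0 * L ^ 2 ≤ δ * μ / 40 := by
    have h1 := sq_div_le_of_Kmin_le hK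
    rw [← hδ, div_le_iff₀ (by positivity)] at h1
    have h5 : (5 : ℝ) ≤ √30 := Real.le_sqrt_of_sq_le (by norm_num)
    have h2 : 40 * (L ^ 2 * θ) ≤ 8 * √30 * (L ^ 2 * θ) := by
      have : 0 ≤ L ^ 2 * θ := by
        have : 0 < θ := by linarith
        positivity
      nlinarith
    unfold stepsize
    rw [Nat.cast_zero, zero_add, div_mul_eq_mul_div, div_le_iff₀ (by positivity)]
    have e : δ * μ / 40 * (m * μ * K) = K * (δ * m * μ ^ 2) / 40 := by ring
    rw [e]
    linarith
  have hαL : ∀ t, stepsize m θ μ K t * L ^ 2 ≤ δ * μ / 40 := fun t =>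
    (mul_le_mul_of_nonneg_right (hα0 t) (sq_nonneg L)).trans hα40
  have hαμ : ∀ t, stepsize m θ μ K t * μ ≤ δ / 40 := fun t => by
    have h1 : stepsize m θ μ K t * μ * μ ≤ δ / 40 * μ := by
      have : stepsize m θ μ K t * μ ^ 2 ≤ stepsize m θ μ K t * L ^ 2 := by
        have := (hαpos t).le
        gcongr
      linarith [hαL t]
    exact le_of_mul_le_mul_right h1 hμ
  refine ⟨hm, hθ, hδ0, hδ1, ?_, by have := sigmaSq_nonneg f xs; positivity, fun t => ?_, hKθ,
    two_mul_div_le_of_Kmin_le hK, ?_, fun t l => trackErr_nonneg t l,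
    fun t l => meanConsErr_nonneg t l, fun t => trackErr_epoch h0 t, fun t => meanConsErr_epoch t,
    fun t l hl => ?_, fun t l hl => ?_⟩
  · have e : L ^ 2 / (μ ^ 2 * δ) * δ = L ^ 2 / μ ^ 2 := by field_simp
    rw [e, one_le_div (by positivity)]
    gcongr
  · unfold stepsize
    have : (t : ℝ) + K ≠ 0 := by positivity
    field_simp
  · have e : L ^ 2 / (μ ^ 2 * δ) * (stepsize m θ μ K 0 * μ)
        = stepsize m θ μ K 0 * L ^ 2 / (δ * μ) := by field_simp
    rw [e, div_le_iff₀ (by positivity)]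
    linarith
  · have h1 : δ * μ ≤ μ := mul_le_of_le_one_left hμ.le hδ1
    refine (trackErr_succ_le hn hm hW hf hπ h0 hμ (hαpos t) (by linarith [hαL t])
      (by linarith [hαμ t]) hl).trans (le_of_eq ?_)
    field_simp
  · have h1 : 64 * (stepsize m θ μ K t ^ 2 * L ^ 2) ≤ δ ^ 2 := by
      have h2 : stepsize m θ μ K t * L ≤ δ / 40 := by
        have : stepsize m θ μ K t * L * L ≤ δ / 40 * L := by
          have : δ * μ ≤ δ * L := by gcongr
          linarith [hαL t]
        exact le_of_mul_le_mul_right this hL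
      have h3 : 0 ≤ stepsize m θ μ K t * L := by
        have := (hαpos t).le
        positivity
      nlinarith
    refine (meanConsErr_succ_le hn hm hW hf hπ h0 hδ.symm hδ0 h1 hl).trans (le_of_eq ?_)
    field_simp

/-- An upper bound for `X̂_1 / (n m)` that is uniform in `m ≥ 1`, see `X1_le`. -/
noncomputable def noiseConst (μ L ρ s D E : ℝ) : ℝ :=
  30 * L ^ 2 / (1 - ρ ^ 2) * (D + E + 28 * (μ + L) * s / (μ * L ^ 2))
    + 15 * ρ ^ 2 / (1 - ρ ^ 2) * s + μ * (1 - ρ ^ 2) / (8 * L) * s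

/-- The constant of the rate: a bound for `m C₂`, plus one to absorb the terms that decay faster
than `1 / T ^ 2`. -/
noncomputable def rateConst (θ μ L ρ s D E : ℝ) : ℝ :=
  2 * θ ^ 3 * L * s / (μ ^ 3 * (θ - 4))
    + 96 * θ ^ 3 * L ^ 2 * noiseConst μ L ρ s D E / (μ ^ 4 * (1 - ρ ^ 2) ^ 2 * (θ - 4))
    + 4 * θ ^ 2 * noiseConst μ L ρ s D E / (μ ^ 2 * (1 - ρ ^ 2) ^ 2) + 1

lemma rateConst_zero (θ μ L ρ : ℝ) : rateConst θ μ L ρ 0 0 0 = 1 := by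
  simp [rateConst, noiseConst]

lemma X1_nonneg {ρ s h : ℝ} (hμ : 0 < μ) (hL : 0 < L) (hρ : 0 < 1 - ρ ^ 2) (hs : 0 ≤ s)
    (hh : 0 ≤ h) : 0 ≤ X1 n m μ L ρ s h := by
  unfold X1 X0
  positivity

lemma C2_nonneg {ρ s X : ℝ} (hθ : 12 < θ) (hμ : 0 < μ) (hL : 0 < L) (hs : 0 ≤ s) (hX : 0 ≤ X) :
    0 ≤ C2 n m θ μ L ρ s X := by
  have : 0 < θ - 4 := by linarith
  have : 0 < θ := by linarith
  unfold C2
  positivity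

lemma X1_le {ρ s h D E : ℝ} (hm : 0 < m) (hμ : 0 < μ) (hL : 0 < L) (hρ : 0 < 1 - ρ ^ 2)
    (hs : 0 ≤ s) (hDE : h ≤ D + E) (h0 : 0 ≤ D + E) :
    X1 n m μ L ρ s h ≤ n * m * noiseConst μ L ρ s D E := by
  have hm' : (1 : ℝ) ≤ m := by exact_mod_cast hm
  have hX0 : X0 m μ L s h ≤ m * (D + E + 28 * (μ + L) * s / (μ * L ^ 2)) := by
    unfold X0
    have h1 : D + E ≤ m * (D + E) := le_mul_of_one_le_left h0 hm'
    have h2 : 28 * (m * μ + L) * s / (μ * L ^ 2) ≤ m * (28 * (μ + L) * s / (μ * L ^ 2)) := by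
      rw [mul_div_assoc']
      refine div_le_div_of_nonneg_right ?_ (by positivity)
      have : L * s ≤ m * (L * s) := le_mul_of_one_le_left (by positivity) hm'
      linarith
    linarith
  have h1 : 30 * n * L ^ 2 / (1 - ρ ^ 2) * X0 m μ L s h
      ≤ 30 * n * L ^ 2 / (1 - ρ ^ 2) * (m * (D + E + 28 * (μ + L) * s / (μ * L ^ 2))) := by
    gcongr
  have h2 : 15 * n * ρ ^ 2 / (1 - ρ ^ 2) * s ≤ m * (15 * n * ρ ^ 2 / (1 - ρ ^ 2) * s) :=
    le_mul_of_one_le_left (by positivity) hm'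
  have e : n * m * noiseConst μ L ρ s D E
      = 30 * n * L ^ 2 / (1 - ρ ^ 2) * (m * (D + E + 28 * (μ + L) * s / (μ * L ^ 2)))
        + m * (15 * n * ρ ^ 2 / (1 - ρ ^ 2) * s) + m * n * μ * (1 - ρ ^ 2) / (8 * L) * s := by
    unfold noiseConst
    ring
  rw [e]
  unfold X1
  linarith

lemma mul_C2_add_one_le {ρ s X D E : ℝ} (hn : 0 < n) (hm : 0 < m) (hθ : 12 < θ) (hμ : 0 < μ)
    (hL : 0 < L) (hρ : 0 < 1 - ρ ^ 2) (hX : X ≤ n * m * noiseConst μ L ρ s D E) :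
    m * C2 n m θ μ L ρ s X + 1 ≤ rateConst θ μ L ρ s D E := by
  have hn' : (0 : ℝ) < n := by positivity
  have hm' : (0 : ℝ) < m := by positivity
  have hθ4 : 0 < θ - 4 := by linarith
  have hθ0 : 0 < θ := by linarith
  have hZ : X / (n * m) ≤ noiseConst μ L ρ s D E := by
    rw [div_le_iff₀ (by positivity)]
    linarith
  have e : m * C2 n m θ μ L ρ s X = 2 * θ ^ 3 * L * s / (μ ^ 3 * (θ - 4))
      + 96 * θ ^ 3 * L ^ 2 * (X / (n * m)) / (μ ^ 4 * (1 - ρ ^ 2) ^ 2 * (θ - 4))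
      + 4 * θ ^ 2 * (X / (n * m)) / (μ ^ 2 * (1 - ρ ^ 2) ^ 2) := by
    unfold C2
    field_simp
  rw [e]
  unfold rateConst
  gcongr

/-- The explicit bound in positive dimension, where `μ ≤ L` and hence `L > 0`. -/
lemma expErr_le (hp : 0 < p) (hn : 0 < n) (hm : 0 < m) (hW : IsMixingMatrix G W)
    (hρ : rhoW W < 1) (hμ : 0 < μ) (hf : ∀ i l, IsStronglyConvexSmooth μ L (f i l))
    (hxs : IsMinOn (objective f) Set.univ xs) (hπ : IsUniformReshuffling P π)
    (hθ : 12 < θ) (hK : Kmin m θ μ L (rhoW W) ≤ K) (t : ℕ) :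
    expErr P W f (stepsize m θ μ K) π x₀ xs t ≤
      (K / (t + K)) ^ (θ / 2) * ‖avg x₀ - xs‖ ^ 2
      + (C1 θ μ L (rhoW W) K t + ((1 + rhoW W ^ 2) / 2) ^ (m * t)) * (consErr x₀ / n)
      + C2 n m θ μ L (rhoW W) (sigmaSq f xs) (X1 n m μ L (rhoW W) (sigmaSq f xs)
          (H0 μ L (rhoW W) (stepsize m θ μ K 0) x₀ xs)) / (t + K) ^ 2 := by
  have hrec := errorRecursion (x₀ := x₀) hp hn hm hW hρ hμ hf hxs hπ hθ hK
  have hL : 0 < L := hμ.trans_le ((hf ⟨0, hn⟩ ⟨0, hm⟩).le hp)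
  have hδ0 := hrec.delta_pos
  have hδ1 := hrec.delta_le
  have hτ := hrec.tau_pos t
  have hn' : (0 : ℝ) < n := by positivity
  have hm' : (0 : ℝ) < m := by positivity
  have hθ4 : 0 < θ - 4 := by linarith
  have hθ0 : 0 < θ := by linarith
  have hs := sigmaSq_nonneg f xs
  set s := sigmaSq f xs
  set ρ := rhoW W
  have hq : (1 + ρ ^ 2) / 2 = 1 - (1 - ρ ^ 2) / 2 := by ring
  set δ := 1 - ρ ^ 2 with hδ
  set α₀ := stepsize m θ μ K 0 with hα₀
  have hα₀pos : 0 < α₀ := pos_of_mul_pos_left (hrec.r_pos 0) hμ.le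
  set h := H0 μ L ρ α₀ x₀ xs with hh
  have hh0 : ‖avg x₀ - xs‖ ^ 2 + 16 * (L ^ 2 / (μ ^ 2 * δ) * (α₀ * μ)) * (consErr x₀ / n) = h := by
    rw [hh, H0, omega0, ← hδ]
    field_simp
  have hc0 := consErr_nonneg x₀
  have hhnn : 0 ≤ h := by rw [← hh0]; positivity
  have hX : 28 * (m * (s / L ^ 2)) ≤ X0 m μ L s h := by
    have e : X0 m μ L s h = h + 28 * (m * (s / L ^ 2)) + 28 * s / (μ * L) := by
      unfold X0
      field_simp
      ring
    rw [e]
    have : 0 ≤ 28 * s / (μ * L) := by positivity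
    linarith
  have hinit : trackErr P W f (stepsize m θ μ K) π x₀ xs 0 0
      + 16 * (L ^ 2 / (μ ^ 2 * δ) * (α₀ * μ)) * meanConsErr P W f (stepsize m θ μ K) π x₀ 0 0
      ≤ X0 m μ L s h := by
    rw [trackErr_init, meanConsErr_init, hh0]
    unfold X0
    exact le_add_of_nonneg_right (by positivity)
  have hY : 30 * (L ^ 2 / (μ ^ 2 * δ) * X0 m μ L s h) ≤ X1 n m μ L ρ s h / (n * μ ^ 2) := by
    have e : X1 n m μ L ρ s h / (n * μ ^ 2) = 30 * (L ^ 2 / (μ ^ 2 * δ) * X0 m μ L s h)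
        + (15 * ρ ^ 2 / (μ ^ 2 * δ) * s + m * δ / (8 * L * μ) * s) := by
      unfold X1
      rw [← hδ]
      field_simp
      ring
    rw [e]
    exact le_add_of_nonneg_right (by positivity)
  have hX1 : 0 ≤ X1 n m μ L ρ s h := X1_nonneg hμ hL hδ0 hs hhnn
  have ha := hrec.a_zero_le hX hinit hY t
  have hb := hrec.b_le_four hX hinit hY t (Nat.zero_le m)
  rw [trackErr_init, meanConsErr_init] at ha
  rw [meanConsErr_init, add_zero] at hb
  have hb2 : 4 / δ * ((stepsize m θ μ K t * μ) ^ 2 * (X1 n m μ L ρ s h / (n * μ ^ 2)))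
      ≤ 4 * θ ^ 2 * X1 n m μ L ρ s h / (n * μ ^ 2 * m ^ 2 * δ ^ 2) / (t + K) ^ 2 := by
    have e : 4 / δ * ((stepsize m θ μ K t * μ) ^ 2 * (X1 n m μ L ρ s h / (n * μ ^ 2)))
        = 4 * θ ^ 2 * X1 n m μ L ρ s h / (n * μ ^ 2 * m ^ 2 * δ) / (t + K) ^ 2 := by
      unfold stepsize
      field_simp
    rw [e]
    gcongr
    nlinarith
  have ha2 : 96 * θ ^ 3 * (L ^ 2 / (μ ^ 2 * δ)) * (X1 n m μ L ρ s h / (n * μ ^ 2))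
        / (m ^ 2 * δ * (θ - 4))
      = 96 * θ ^ 3 * L ^ 2 * X1 n m μ L ρ s h / (n * m ^ 2 * μ ^ 4 * δ ^ 2 * (θ - 4)) := by
    field_simp
  rw [ha2] at ha
  have hfirst : 0 ≤ 2 * θ ^ 3 * L * s / (m * μ ^ 3 * (θ - 4)) / (t + K) ^ 2 := by positivity
  -- the first summand of `C2` is nonnegative and is dropped
  rw [expErr_eq hn hπ, hq]
  unfold C1 C2
  rw [← hδ, add_div, add_div]
  have e1 : (K / (t + K)) ^ (θ / 2) * (‖avg x₀ - xs‖ ^ 2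
      + 96 * (L ^ 2 / (μ ^ 2 * δ)) * (consErr x₀ / n))
      = (K / (t + K)) ^ (θ / 2) * ‖avg x₀ - xs‖ ^ 2
      + (K / (t + K)) ^ (θ / 2) * (96 * L ^ 2 / (μ ^ 2 * δ)) * (consErr x₀ / n) := by ring
  rw [e1] at ha
  rw [add_mul]
  linarith

/-- A power larger than two of `K / (T + K)` and a geometric term vanish faster than
`1 / T ^ 2`. -/
lemma eventually_transient_le (hθ : 12 < θ) (hK : 0 < K) {q : ℝ} (hq0 : 0 ≤ q) (hq1 : q < 1)
    (hm : 0 < m) {A B : ℝ} (hA : 0 ≤ A) (hB : 0 ≤ B) :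
    ∀ᶠ T : ℕ in atTop,
      m * T ^ 2 * ((K / (T + K)) ^ (θ / 2) * A + q ^ (m * T) * B) ≤ 1 := by
  have h1 : Tendsto (fun T : ℕ => m * A * K ^ 3 * (T : ℝ)⁻¹ + m * B * ((T : ℝ) ^ 2 * q ^ T)) atTop
      (𝓝 (m * A * K ^ 3 * 0 + m * B * 0)) :=
    (tendsto_inv_atTop_nhds_zero_nat.const_mul _).add
      ((tendsto_pow_const_mul_const_pow_of_lt_one 2 hq0 hq1).const_mul _)
  rw [mul_zero, mul_zero, add_zero] at h1
  filter_upwards [h1.eventually (ge_mem_nhds zero_lt_one), eventually_gt_atTop 0] with T hT hT0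
  refine le_trans ?_ hT
  have hT' : (0 : ℝ) < T := by exact_mod_cast hT0
  have h2 : (K / (T + K)) ^ (θ / 2) ≤ (K / (T + K)) ^ 3 := by
    have hle : K / (T + K) ≤ 1 := by
      rw [div_le_one (by positivity)]
      linarith
    rw [← Real.rpow_natCast]
    refine Real.rpow_le_rpow_of_exponent_ge (by positivity) hle ?_
    push_cast
    linarith
  have h3 : (T : ℝ) ^ 2 * (K / (T + K)) ^ 3 ≤ K ^ 3 * (T : ℝ)⁻¹ := by
    have e : K ^ 3 * (T : ℝ)⁻¹ = (T : ℝ) ^ 2 * (K / T) ^ 3 := by field_simp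
    rw [e]
    gcongr
    linarith
  have h4 : q ^ (m * T) ≤ q ^ T :=
    pow_le_pow_of_le_one hq0 hq1.le (Nat.le_mul_of_pos_left T hm)
  have h5 : (T : ℝ) ^ 2 * (K / (T + K)) ^ (θ / 2) ≤ K ^ 3 * (T : ℝ)⁻¹ :=
    (mul_le_mul_of_nonneg_left h2 (by positivity)).trans h3
  have h6 : (T : ℝ) ^ 2 * q ^ (m * T) ≤ T ^ 2 * q ^ T := by gcongr
  have hmA : 0 ≤ (m : ℝ) * A := by positivity
  have hmB : 0 ≤ (m : ℝ) * B := by positivity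
  have h7 := mul_le_mul_of_nonneg_left h5 hmA
  have h8 := mul_le_mul_of_nonneg_left h6 hmB
  linarith

/-- The rate in positive dimension. -/
lemma eventually_expErr_le (hp : 0 < p) (hn : 0 < n) (hm : 0 < m) (hW : IsMixingMatrix G W)
    (hρ : rhoW W < 1) (hμ : 0 < μ) (hf : ∀ i l, IsStronglyConvexSmooth μ L (f i l))
    (hxs : IsMinOn (objective f) Set.univ xs) (hπ : IsUniformReshuffling P π)
    (hθ : 12 < θ) (hK : Kmin m θ μ L (rhoW W) ≤ K) :
    ∀ᶠ T : ℕ in atTop, expErr P W f (stepsize m θ μ K) π x₀ xs T ≤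
      rateConst θ μ L (rhoW W) (sigmaSq f xs) (‖avg x₀ - xs‖ ^ 2) (consErr x₀ / n)
        / (m * T ^ 2) := by
  have hrec := errorRecursion (x₀ := x₀) hp hn hm hW hρ hμ hf hxs hπ hθ hK
  have hL : 0 < L := hμ.trans_le ((hf ⟨0, hn⟩ ⟨0, hm⟩).le hp)
  have hδ0 := hrec.delta_pos
  have hn' : (0 : ℝ) < n := by positivity
  have hm' : (0 : ℝ) < m := by positivity
  have hs := sigmaSq_nonneg f xs
  have hE : 0 ≤ consErr x₀ / n := div_nonneg (consErr_nonneg x₀) hn'.le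
  have hK0 : 0 < K := by linarith [hrec.K_ge_half]
  have hα₀pos : 0 < stepsize m θ μ K 0 := pos_of_mul_pos_left (hrec.r_pos 0) hμ.le
  have hH : H0 μ L (rhoW W) (stepsize m θ μ K 0) x₀ xs
      = ‖avg x₀ - xs‖ ^ 2 + 16 * (L ^ 2 / (μ ^ 2 * (1 - rhoW W ^ 2)) * (stepsize m θ μ K 0 * μ))
        * (consErr x₀ / n) := by
    rw [H0, omega0]
    field_simp
  have hHnn : 0 ≤ H0 μ L (rhoW W) (stepsize m θ μ K 0) x₀ xs := by rw [hH]; positivity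
  have hHle : H0 μ L (rhoW W) (stepsize m θ μ K 0) x₀ xs
      ≤ ‖avg x₀ - xs‖ ^ 2 + consErr x₀ / n := by
    rw [hH]
    have := mul_le_mul_of_nonneg_right hrec.kappa_r_le hE
    linarith
  have hC2 := mul_C2_add_one_le hn hm hθ hμ hL hδ0
    (X1_le (n := n) hm hμ hL hδ0 hs hHle (by positivity))
  have hC2nn : 0 ≤ C2 n m θ μ L (rhoW W) (sigmaSq f xs) (X1 n m μ L (rhoW W) (sigmaSq f xs)
      (H0 μ L (rhoW W) (stepsize m θ μ K 0) x₀ xs)) :=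
    C2_nonneg hθ hμ hL hs (X1_nonneg hμ hL hδ0 hs hHnn)
  have hA : 0 ≤ ‖avg x₀ - xs‖ ^ 2
      + 96 * L ^ 2 / (μ ^ 2 * (1 - rhoW W ^ 2)) * (consErr x₀ / n) := by positivity
  filter_upwards [eventually_transient_le hθ hK0 (q := (1 + rhoW W ^ 2) / 2) (by positivity)
    (by linarith) hm hA hE, eventually_gt_atTop 0] with T hT hT0
  have hT' : (0 : ℝ) < T := by exact_mod_cast hT0
  have hle := expErr_le (x₀ := x₀) hp hn hm hW hρ hμ hf hxs hπ hθ hK T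
  set c₂ := C2 n m θ μ L (rhoW W) (sigmaSq f xs) (X1 n m μ L (rhoW W) (sigmaSq f xs)
      (H0 μ L (rhoW W) (stepsize m θ μ K 0) x₀ xs)) with hc₂
  rw [le_div_iff₀ (by positivity)]
  have h1 : c₂ / (T + K) ^ 2 ≤ c₂ / T ^ 2 := by
    gcongr
    linarith
  have h2 : c₂ / T ^ 2 * (m * T ^ 2) = m * c₂ := by field_simp
  have h3 : 0 < (m : ℝ) * T ^ 2 := by positivity
  have h4 := mul_le_mul_of_nonneg_right (hle.trans (add_le_add_right h1 _)) h3.le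
  unfold C1 at h4
  linarith

end Bounds

end DRR

theorem mainTheorem1 :
    ∃ C : ℝ → ℝ → ℝ → ℝ → ℝ → ℝ → ℝ → ℝ,
    ∀ {Ω : Type*} [MeasurableSpace Ω] (P : MeasureTheory.Measure Ω)
      [MeasureTheory.IsProbabilityMeasure P]
      {n m p : ℕ} (_ : 0 < m)
      (G : SimpleGraph (Fin n)) (_ : G.Connected)
      (W : Matrix (Fin n) (Fin n) ℝ) (_ : DRR.IsMixingMatrix G W)
      (_ : (∃ i, 0 < W i i) ∨ ¬ G.Colorable 2)
      (μ L : ℝ) (_ : 0 < μ)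
      (f : Fin n → Fin m → DRR.Vec p → ℝ)
      (_ : ∀ i l, DRR.IsStronglyConvexSmooth μ L (f i l))
      (xs : DRR.Vec p) (_ : IsMinOn (DRR.objective f) Set.univ xs)
      (π : ℕ → Fin n → Ω → Equiv.Perm (Fin m)) (_ : DRR.IsUniformReshuffling P π)
      (x₀ : Fin n → DRR.Vec p)
      (θ K : ℝ) (_ : 12 < θ) (_ : DRR.Kmin m θ μ L (DRR.rhoW W) ≤ K),
      -- the squared errors are integrable, and the explicit bound holds at every epoch
      (∀ (t : ℕ),
        (∀ i, MeasureTheory.Integrable (fun ω =>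
          ‖DRR.iterate W f (DRR.stepsize m θ μ K) (fun s j => π s j ω) x₀ t i - xs‖ ^ 2) P) ∧
        DRR.expErr P W f (DRR.stepsize m θ μ K) π x₀ xs t ≤
          (K / (t + K)) ^ (θ / 2) * ‖DRR.avg x₀ - xs‖ ^ 2
          + (DRR.C1 θ μ L (DRR.rhoW W) K t + ((1 + DRR.rhoW W ^ 2) / 2) ^ (m * t))
              * (DRR.consErr x₀ / n)
          + DRR.C2 n m θ μ L (DRR.rhoW W) (DRR.sigmaSq f xs)
              (DRR.X1 n m μ L (DRR.rhoW W) (DRR.sigmaSq f xs)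
                (DRR.H0 μ L (DRR.rhoW W) (DRR.stepsize m θ μ K 0) x₀ xs))
            / (t + K) ^ 2) ∧
      -- the resulting rate `O(1/(m T²))`, with a constant that does not depend on `m`, `n`, `K`
      (∃ T₀ : ℕ, ∀ T : ℕ, T₀ ≤ T →
        DRR.expErr P W f (DRR.stepsize m θ μ K) π x₀ xs T ≤
          C θ μ L (DRR.rhoW W) (DRR.sigmaSq f xs) (‖DRR.avg x₀ - xs‖ ^ 2) (DRR.consErr x₀ / n)
            / (m * T ^ 2)) := by
  refine ⟨DRR.rateConst, ?_⟩
  intro Ω _ P _ n m p hm G hG W hW hb μ L hμ f hf xs hxs π hπ x₀ θ K hθ hK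
  have hn : 0 < n := hG.nonempty.elim fun i => i.pos
  have hρ := DRR.rhoW_lt_one hG hW hb
  have hint : ∀ t i, MeasureTheory.Integrable (fun ω =>
      ‖DRR.iterate W f (DRR.stepsize m θ μ K) (fun s j => π s j ω) x₀ t i - xs‖ ^ 2) P :=
    fun t i => ((DRR.finiteValued_iterate hπ W f _ x₀ t).comp fun x => ‖x i - xs‖ ^ 2).integrable
  rcases Nat.eq_zero_or_pos p with rfl | hp
  · -- in dimension zero every error vanishes
    have hv : ∀ v : DRR.Vec 0, v = 0 := fun v => Subsingleton.elim _ _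
    have hz : ∀ t, DRR.expErr P W f (DRR.stepsize m θ μ K) π x₀ xs t = 0 := fun t => by
      simp [DRR.expErr, hv (_ - xs)]
    have hs : DRR.sigmaSq f xs = 0 := by simp [DRR.sigmaSq, hv (gradient _ _)]
    have hD : ‖DRR.avg x₀ - xs‖ ^ 2 = 0 := by simp [hv (_ - xs)]
    have hE : DRR.consErr x₀ = 0 := by simp [DRR.consErr, hv (_ - DRR.avg x₀)]
    refine ⟨fun t => ⟨hint t, ?_⟩, 0, fun T _ => ?_⟩
    · rw [hz, DRR.H0, hD, hE, hs]
      simp [DRR.X1, DRR.X0, DRR.C2]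
    · rw [hz, hD, hE, hs, zero_div, DRR.rateConst_zero]
      positivity
  · exact ⟨fun t => ⟨hint t, DRR.expErr_le hp hn hm hW hρ hμ hf hxs hπ hθ hK t⟩,
      Filter.eventually_atTop.1
        (DRR.eventually_expErr_le hp hn hm hW hρ hμ hf hxs hπ hθ hK)⟩
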